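/- Let $q$ be an indeterminate, let $[r]=(1-q^r)/(1-q)$ denote the $q$-integer, let $(x;q)_0=1$ and $(x;q)_k=(1-x)(1-xq)\cdots(1-xq^{k-1})$ for $k\ge 1$, and let $\Phi_n(q)$ be the $n$-th cyclotomic polynomial. For rational functions $A(q),B(q)\in\mathbb{Q}(q)$ and a polynomial $P(q)\in\mathbb{Z}[q]$, write $A(q)\equiv B(q)\pmod{P(q)}$ if $P(q)$ divides, in $\mathbb{Z}[q]$, the numerator of $A(q)-B(q)$ written in lowest terms as a quotient of two polynomials in $\mathbb{Z}[q]$. Let $n$ be a positive odd integer, and for integers $k\ge 0$ let $$\theta_q(k)=[4k+1]\frac{(q;q^2)_k^4}{(q^2;q^2)_k^4}.$$ Then $$\sum_{\substack{i,j\ge 0\\ i+j\le n-1}}\theta_q(i)\theta_q(j)\equiv [n]^2q^{1-n}-2[n]^4\sum_{t=1}^{(n-1)/2}\frac{q^{2t+1}}{[2t]^2}\pmod{[n]\Phi_n(q)^4}.$$ -/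

import Mathlib

open Polynomial

noncomputable section

namespace QCong

/-- The `q`-shifted factorial `(x;q)_k = (1-x)(1-xq)⋯(1-xq^{k-1})`. -/
def qPoch {K : Type*} [CommRing K] (x q : K) (k : ℕ) : K :=
  ∏ i ∈ Finset.range k, (1 - x * q ^ i)

/-- The indeterminate `q` of the field `ℤ(q) = ℚ(q)` of rational functions, that is, the field of
fractions of `ℤ[q]`. -/
abbrev q : RatFunc ℤ := RatFunc.X

/-- The `q`-integer `[r] = (1-q^r)/(1-q)`, as a rational function. -/
def qInt (r : ℕ) : RatFunc ℤ := (1 - q ^ r) / (1 - q)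

/-- The `q`-integer `[r] = 1 + q + ⋯ + q^{r-1}`, as a polynomial. -/
def qIntPoly (r : ℕ) : ℤ[X] := ∑ i ∈ Finset.range r, X ^ i

/-- The two forms of the `q`-integer agree. -/
theorem algebraMap_qIntPoly (r : ℕ) : algebraMap ℤ[X] (RatFunc ℤ) (qIntPoly r) = qInt r := by
  have h : (1 : RatFunc ℤ) - q ≠ 0 := by
    rw [sub_ne_zero, q, ← RatFunc.algebraMap_X, ← map_one (algebraMap ℤ[X] (RatFunc ℤ))]
    intro h
    exact X_ne_C (1 : ℤ) (RatFunc.algebraMap_injective ℤ h).symm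
  rw [qInt, eq_div_iff h, qIntPoly, map_sum]
  simp only [map_pow, RatFunc.algebraMap_X]
  exact geom_sum_mul_neg _ _

/-- Congruence of rational functions in `q` modulo a polynomial `P ∈ ℤ[q]`: in lowest terms, the
numerator of `f - g` is divisible by `P` in `ℤ[q]`. -/
def RatCongr (P : ℤ[X]) (f g : RatFunc ℤ) : Prop :=
  P ∣ IsFractionRing.num ℤ[X] (f - g)

/-- `θ_q(k) = [4k+1] (q;q²)_k⁴ / (q²;q²)_k⁴`. -/
def theta (k : ℕ) : RatFunc ℤ :=
  qInt (4 * k + 1) * (qPoch q (q ^ 2) k ^ 4 / qPoch (q ^ 2) (q ^ 2) k ^ 4)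

end QCong

end

/-! Write n = 2m+1, e = 1 - q^n, a_k = `wpRatio q 1 k`, b_k = `wpRatio q (q ^ n) k`, so that (1-q)
θ_q(k) = (1 - q^{4k+1}) a_k^4. Since [n] is the product of Φ_d over the divisors d > 1 of n, it
suffices to show that the difference of the two sides is divisible by Φ_n^5 and by Φ_d for every
other such d. Divisibility is tested by evaluation at a primitive root of unity ζ: a rational
function regular at ζ with value 0 is Φ times a regular one.

Modulo Φ_n^5. Splitting the indices at m turns the double sum into the square of the head ∑_{k≤m}
plus twice a sum over i > m. For i > m the term a_i contains the factor e, so the tail is e^4 times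
a sum, and that sum vanishes at ζ by antisymmetry (`exists_sum_tail`). For the head, a_k - b_k is
divisible by e, and ∑ (1 - q^{4k+1}) a_k (a_k - b_k)^3 is e^3 times a function that again vanishes
at ζ by antisymmetry under k ↦ m - k (`exists_sum_wp_cube`). Expanding the cube expresses ∑ (1 -
q^{4k+1}) a_k^4 through sums with at least one factor b_k; these are terminating ₆φ₅ sums with
product values (`sum_wp`), and expanding the products in powers of e gives the head
(`exists_sum_theta`). Squaring it and using q^{-2m} = q at ζ gives the right-hand side.

Modulo Φ_d with d ∣ n, 1 < d < n. The a_k satisfy a Lucas-type factorization at a primitive d-th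
root of unity (`exists_hasValue_wpRatio`), so the sum breaks into blocks of length d, each of which
vanishes by the same antisymmetry. The right-hand side vanishes too, because [n]/[2t] is regular
there. -/

namespace QCong

/-! ### A terminating very-well-poised sum -/

section WellPoised

variable {K : Type*} [Field K]

/-- The product `∏_{j<k} (y - q^{2j+1}) / (1 - y q^{2j+2})`. -/
def wpRatio (q y : K) (k : ℕ) : K :=
  ∏ j ∈ Finset.range k, (y - q ^ (2 * j + 1)) / (1 - y * q ^ (2 * j + 2))

theorem wpRatio_zero (q y : K) : wpRatio q y 0 = 1 := by simp [wpRatio]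

theorem wpRatio_succ (q y : K) (k : ℕ) :
    wpRatio q y (k + 1) = wpRatio q y k * ((y - q ^ (2 * k + 1)) / (1 - y * q ^ (2 * k + 2))) :=
  Finset.prod_range_succ _ _

theorem wpRatio_eq_zero (q : K) {m k : ℕ} (h : m < k) : wpRatio q (q ^ (2 * m + 1)) k = 0 :=
  Finset.prod_eq_zero (Finset.mem_range.2 h) (by simp)

theorem wpRatio_shift {q Y : K} (hY : ∀ j : ℕ, 1 - Y * q ^ (2 * j + 2) ≠ 0) (k : ℕ) :
    wpRatio q Y k * (q ^ (2 * k) * (q * Y - 1) * (1 - q ^ 2 * Y)) =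
      wpRatio q (q ^ 2 * Y) k * ((q * Y - q ^ (2 * k)) * (1 - q ^ 2 * q ^ (2 * k) * Y)) := by
  induction k with
  | zero => simp [wpRatio_zero]
  | succ k ih =>
    rw [wpRatio_succ, wpRatio_succ]
    have h1 := hY k
    have h2 : 1 - q ^ 2 * Y * q ^ (2 * k + 2) ≠ 0 := by
      have := hY (k + 1)
      rwa [show Y * q ^ (2 * (k + 1) + 2) = q ^ 2 * Y * q ^ (2 * k + 2) by ring] at this
    have e1 : q ^ (2 * (k + 1)) = q ^ 2 * q ^ (2 * k) := by ring
    have e2 : q ^ (2 * k + 1) = q * q ^ (2 * k) := by ring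
    have e3 : q ^ (2 * k + 2) = q ^ 2 * q ^ (2 * k) := by ring
    simp only [e1, e2, e3] at h1 h2 ih ⊢
    generalize wpRatio q Y k = A at *
    generalize wpRatio q (q ^ 2 * Y) k = B at *
    generalize q ^ (2 * k) = X at *
    rw [mul_div_assoc', mul_div_assoc', div_mul_eq_mul_div, div_mul_eq_mul_div,
      div_eq_div_iff h1 h2]
    linear_combination (Y - q * X) * q ^ 2 * (1 - q ^ 2 * Y * (q ^ 2 * X)) * ih

/-- A Gosper-type certificate. By `wpRatio_shift`, the bracket is the combination of the summands
with fourth parameter q²Y and Y that yields the recurrence from m to m+1 in `sum_wp`, up to the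
common factor qY - 1. -/
theorem sum_wp_telescope {q : K} (hq0 : q ≠ 0) (hq : ∀ j : ℕ, 1 - q ^ (j + 1) ≠ 0) {y z Y : K}
    (hy : ∀ j : ℕ, 1 - y * q ^ (2 * j + 2) ≠ 0) (hz : ∀ j : ℕ, 1 - z * q ^ (2 * j + 2) ≠ 0)
    (hY : ∀ j : ℕ, 1 - q ^ 2 * Y * q ^ (2 * j + 2) ≠ 0) (N : ℕ) :
    ∑ k ∈ Finset.range N, (1 - q ^ (4 * k + 1)) * wpRatio q 1 k * wpRatio q (q ^ 2 * Y) k *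
        wpRatio q y k * wpRatio q z k *
        (((1 - q * Y * y) * (1 - q * Y * z) * q ^ (2 * k) * (q * Y - 1) -
          (1 - Y * y * z) * (q * Y - q ^ (2 * k)) * (1 - q ^ 2 * q ^ (2 * k) * Y)) / q ^ (2 * k)) =
      q * Y * wpRatio q 1 N * wpRatio q (q ^ 2 * Y) N * wpRatio q y N * wpRatio q z N *
        ((1 - q ^ (2 * N)) * (1 - y * q ^ (2 * N)) * (1 - z * q ^ (2 * N)) *
          (1 - q ^ 2 * Y * q ^ (2 * N)) / q ^ (2 * N)) := by
  induction N with
  | zero => simp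
  | succ k ih =>
    rw [Finset.sum_range_succ, ih]
    simp only [wpRatio_succ]
    have h1 : 1 - 1 * q ^ (2 * k + 2) ≠ 0 := by simpa using hq (2 * k + 1)
    have h2 := hy k
    have h3 := hz k
    have h4 := hY k
    have e0 : q ^ (4 * k + 1) = q * (q ^ (2 * k)) ^ 2 := by ring
    have e1 : q ^ (2 * (k + 1)) = q ^ 2 * q ^ (2 * k) := by ring
    have e2 : q ^ (2 * k + 1) = q * q ^ (2 * k) := by ring
    have e3 : q ^ (2 * k + 2) = q ^ 2 * q ^ (2 * k) := by ring
    have hX : q ^ (2 * k) ≠ 0 := pow_ne_zero _ hq0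
    simp only [e0, e1, e2, e3] at h1 h2 h3 h4 ⊢
    generalize q ^ (2 * k) = X at *
    generalize wpRatio q 1 k = A
    generalize wpRatio q y k = B
    generalize wpRatio q z k = C
    generalize wpRatio q (q ^ 2 * Y) k = D
    have s : ∀ u w : K, (1 - u * (q ^ 2 * X)) ≠ 0 →
        w / (1 - u * (q ^ 2 * X)) * (1 - u * (q ^ 2 * X)) = w := fun u w h => div_mul_cancel₀ _ h
    have hfin : q * Y * (A * ((1 - q * X) / (1 - 1 * (q ^ 2 * X)))) *
          (D * ((q ^ 2 * Y - q * X) / (1 - q ^ 2 * Y * (q ^ 2 * X)))) *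
          (B * ((y - q * X) / (1 - y * (q ^ 2 * X)))) *
          (C * ((z - q * X) / (1 - z * (q ^ 2 * X)))) *
          ((1 - q ^ 2 * X) * (1 - y * (q ^ 2 * X)) * (1 - z * (q ^ 2 * X)) *
            (1 - q ^ 2 * Y * (q ^ 2 * X)) / (q ^ 2 * X)) =
        q * Y * A * D * B * C * ((1 - q * X) * (q ^ 2 * Y - q * X) * (y - q * X) * (z - q * X) /
          (q ^ 2 * X)) := by
      calc _ = q * Y * A * D * B * C *
            (((1 - q * X) / (1 - 1 * (q ^ 2 * X)) * (1 - 1 * (q ^ 2 * X))) *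
            ((q ^ 2 * Y - q * X) / (1 - q ^ 2 * Y * (q ^ 2 * X)) *
              (1 - q ^ 2 * Y * (q ^ 2 * X))) *
            ((y - q * X) / (1 - y * (q ^ 2 * X)) * (1 - y * (q ^ 2 * X))) *
            ((z - q * X) / (1 - z * (q ^ 2 * X)) * (1 - z * (q ^ 2 * X))) / (q ^ 2 * X)) := by
              ring
        _ = _ := by rw [s _ _ h1, s _ _ h2, s _ _ h3, s _ _ h4]
    rw [hfin]
    field_simp
    ring

/-- Rogers' terminating ₆φ₅ sum in base q² with a = q and remaining parameters q^{-2m}, q/y, q/z.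
Both sides satisfy the same first-order recurrence in m. -/
theorem sum_wp {q : K} (hq0 : q ≠ 0) (hq : ∀ j : ℕ, 1 - q ^ (j + 1) ≠ 0) {y z : K}
    (hy : ∀ j : ℕ, 1 - y * q ^ (2 * j + 2) ≠ 0) (hz : ∀ j : ℕ, 1 - z * q ^ (2 * j + 2) ≠ 0)
    (m : ℕ) :
    ∑ k ∈ Finset.range (m + 1), (1 - q ^ (4 * k + 1)) * wpRatio q 1 k *
        wpRatio q (q ^ (2 * m + 1)) k * wpRatio q y k * wpRatio q z k =
      (1 - q) * ∏ j ∈ Finset.range m, (1 - q ^ (2 * j + 3)) * (1 - y * z * q ^ (2 * j + 1)) /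
        ((1 - y * q ^ (2 * j + 2)) * (1 - z * q ^ (2 * j + 2))) := by
  induction m with
  | zero => simp [wpRatio_zero]
  | succ m ih =>
    have hY : ∀ i j : ℕ, 1 - q ^ (2 * i + 1) * q ^ (2 * j + 2) ≠ 0 := fun i j => by
      have := hq (2 * i + 2 * j + 2)
      rwa [show q ^ (2 * i + 2 * j + 2 + 1) = q ^ (2 * i + 1) * q ^ (2 * j + 2) by ring] at this
    have eY : q ^ (2 * (m + 1) + 1) = q ^ 2 * q ^ (2 * m + 1) := by ring
    -- With N = m + 2 the boundary term contains the zero factor q^{2m+3} - q^{2(m+1)+1}, so the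
    -- telescoped sum is 0.
    have tel := sum_wp_telescope hq0 hq hy hz (Y := q ^ (2 * m + 1))
      (fun j => by rw [← eY]; exact hY _ j) (m + 2)
    rw [← eY, wpRatio_eq_zero q (m := m + 1) (k := m + 2) (by omega)] at tel
    simp only [mul_zero, zero_mul] at tel
    have h1 : q * q ^ (2 * m + 1) - 1 ≠ 0 := by
      have := hq (2 * m + 1)
      rw [← neg_ne_zero, neg_sub]
      rwa [show q * q ^ (2 * m + 1) = q ^ (2 * m + 1 + 1) by ring]
    have h2 : 1 - q ^ 2 * q ^ (2 * m + 1) ≠ 0 := by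
      have := hq (2 * m + 2)
      rwa [show q ^ 2 * q ^ (2 * m + 1) = q ^ (2 * m + 2 + 1) by ring]
    have key : (∑ k ∈ Finset.range (m + 2), (1 - q ^ (4 * k + 1)) * wpRatio q 1 k *
          wpRatio q (q ^ (2 * (m + 1) + 1)) k * wpRatio q y k * wpRatio q z k) *
          ((1 - q * q ^ (2 * m + 1) * y) * (1 - q * q ^ (2 * m + 1) * z)) =
        (∑ k ∈ Finset.range (m + 2), (1 - q ^ (4 * k + 1)) * wpRatio q 1 k *
          wpRatio q (q ^ (2 * m + 1)) k * wpRatio q y k * wpRatio q z k) *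
          ((1 - q ^ 2 * q ^ (2 * m + 1)) * (1 - q ^ (2 * m + 1) * y * z)) := by
      rw [← sub_eq_zero, ← mul_left_inj' h1, zero_mul, Finset.sum_mul, Finset.sum_mul,
        ← Finset.sum_sub_distrib, Finset.sum_mul, ← tel]
      refine Finset.sum_congr rfl fun k _ => ?_
      have sh := wpRatio_shift (q := q) (Y := q ^ (2 * m + 1)) (hY m) k
      have hX : q ^ (2 * k) ≠ 0 := pow_ne_zero _ hq0
      rw [← eY] at sh
      rw [mul_div_assoc', eq_div_iff hX]
      linear_combination (-((1 - q ^ (4 * k + 1)) * wpRatio q 1 k * wpRatio q y k *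
        wpRatio q z k * (1 - q ^ (2 * m + 1) * y * z))) * sh
    rw [Finset.sum_range_succ _ (m + 1), Finset.sum_range_succ _ (m + 1),
      wpRatio_eq_zero q (m := m) (k := m + 1) (by omega), ih] at key
    rw [Finset.prod_range_succ, ← mul_assoc, mul_div_assoc', eq_div_iff
      (mul_ne_zero (hy m) (hz m)), Finset.sum_range_succ]
    linear_combination key

end WellPoised

/-! ### Products to third order -/

section Expansion

variable {R : Type*} [CommRing R]

/-- The second-order coefficient contains the second elementary symmetric function of the α's, which
is half of (∑ α)² - ∑ α²; the factor 2 avoids the division. -/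
theorem pow_three_dvd_prod_sub (e : R) {f α β : ℕ → R}
    (h : ∀ i, e ^ 3 ∣ f i - (1 + e * α i + e ^ 2 * β i)) (m : ℕ) :
    e ^ 3 ∣ 2 * ∏ i ∈ Finset.range m, f i - (2 + 2 * e * ∑ i ∈ Finset.range m, α i +
      e ^ 2 * ((∑ i ∈ Finset.range m, α i) ^ 2 - ∑ i ∈ Finset.range m, α i ^ 2 +
        2 * ∑ i ∈ Finset.range m, β i)) := by
  induction m with
  | zero => simp
  | succ m ih =>
    simp only [Finset.prod_range_succ, Finset.sum_range_succ]
    obtain ⟨g, hg⟩ := ih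
    obtain ⟨k, hk⟩ := h m
    generalize ∑ i ∈ Finset.range m, α i = A at *
    generalize ∑ i ∈ Finset.range m, α i ^ 2 = A' at *
    generalize ∑ i ∈ Finset.range m, β i = B at *
    generalize ∏ i ∈ Finset.range m, f i = P at *
    refine ⟨g * f m + k * (2 + 2 * e * A + e ^ 2 * (A ^ 2 - A' + 2 * B)) +
      2 * A * β m + (A ^ 2 - A' + 2 * B) * (α m + e * β m), ?_⟩
    linear_combination f m * hg + (2 + 2 * e * A + e ^ 2 * (A ^ 2 - A' + 2 * B)) * hk

/-- Here e stands for 1 - q^n and w_i for 1/(1 - q^{2i+2}). The three products are those of the ₆φ₅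
values for (y,z) = (1,1), (q^n,1), (q^n,q^n), put over a common denominator; 2e - e² and 3e - 3e² +
e³ are 1 - q^{2n} and 1 - q^{3n}. -/
theorem pow_three_dvd_prod_combination (e : R) (w : ℕ → R) (m : ℕ) :
    e ^ 3 ∣ 2 * (3 * ∏ i ∈ Finset.range m, (1 - e * w i) ^ 2 * (1 + e * (w i - 1)) ^ 2 -
      3 * ∏ i ∈ Finset.range m,
        (1 - e * w i) * (1 - (2 * e - e ^ 2) * w i) * (1 + e * (w i - 1)) +
      ∏ i ∈ Finset.range m, (1 - e * w i) * (1 - (3 * e - 3 * e ^ 2 + e ^ 3) * w i) -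
      (∏ i ∈ Finset.range m, (1 - e) * (1 + e * (w i - 1)) ^ 2) *
        (1 - e ^ 2 * ∑ i ∈ Finset.range m, w i * (w i - 1))) := by
  obtain ⟨h1, e1⟩ := pow_three_dvd_prod_sub e
    (f := fun i => (1 - e * w i) ^ 2 * (1 + e * (w i - 1)) ^ 2) (α := fun _ => -2)
    (β := fun i => -2 * w i ^ 2 + 2 * w i + 1)
    (fun i => ⟨2 * w i ^ 2 * (w i - 1) - 2 * w i * (w i - 1) ^ 2 + e * w i ^ 2 * (w i - 1) ^ 2,
      by ring⟩) m
  obtain ⟨h2, e2⟩ := pow_three_dvd_prod_sub e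
    (f := fun i => (1 - e * w i) * (1 - (2 * e - e ^ 2) * w i) * (1 + e * (w i - 1)))
    (α := fun i => -2 * w i - 1) (β := fun i => -w i ^ 2 + 4 * w i)
    (fun i => ⟨-w i ^ 2 + (w i + 2 * w i ^ 2 - e * w i ^ 2) * (w i - 1), by ring⟩) m
  obtain ⟨h3, e3⟩ := pow_three_dvd_prod_sub e
    (f := fun i => (1 - e * w i) * (1 - (3 * e - 3 * e ^ 2 + e ^ 3) * w i))
    (α := fun i => -4 * w i) (β := fun i => 3 * w i ^ 2 + 3 * w i)
    (fun i => ⟨-w i - 3 * w i ^ 2 + e * w i ^ 2, by ring⟩) m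
  obtain ⟨h4, e4⟩ := pow_three_dvd_prod_sub e
    (f := fun i => (1 - e) * (1 + e * (w i - 1)) ^ 2)
    (α := fun i => 2 * w i - 3) (β := fun i => w i ^ 2 - 4 * w i + 3)
    (fun i => ⟨-(w i - 1) ^ 2, by ring⟩) m
  have s1 : ∑ i ∈ Finset.range m, w i * (w i - 1) =
      ∑ i ∈ Finset.range m, w i ^ 2 - ∑ i ∈ Finset.range m, w i := by
    rw [← Finset.sum_sub_distrib]; exact Finset.sum_congr rfl fun i _ => by ring
  have a2 : ∀ i, (-2 * w i - 1) ^ 2 = 4 * w i ^ 2 + 4 * w i + 1 := fun i => by ring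
  have a3 : ∀ i, (-4 * w i) ^ 2 = 16 * w i ^ 2 := fun i => by ring
  have a4 : ∀ i, (2 * w i - 3) ^ 2 = 4 * w i ^ 2 - 12 * w i + 9 := fun i => by ring
  rw [s1]
  simp only [a2, a3, a4, Finset.sum_add_distrib, Finset.sum_sub_distrib, ← Finset.mul_sum,
    Finset.sum_neg_distrib, Finset.sum_const, Finset.card_range, nsmul_eq_mul] at e1 e2 e3 e4
  generalize ∑ i ∈ Finset.range m, w i = W at *
  generalize ∑ i ∈ Finset.range m, w i ^ 2 = V at *
  refine ⟨3 * h1 - 3 * h2 + h3 - h4 + (V - W) * (2 * (2 * W - m * 3) +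
    e * ((2 * W - m * 3) ^ 2 - (4 * V - 12 * W + m * 9) + 2 * (V - 4 * W + m * 3)) +
      e ^ 2 * h4), ?_⟩
  linear_combination 3 * e1 - 3 * e2 + e3 - (1 - e ^ 2 * (V - W)) * e4

end Expansion

/-! ### Antisymmetric sums -/

section Reflection

variable {L : Type*} [Field L]

theorem sum_range_eq_zero_of_antisymm [CharZero L] {a : ℕ → L} {M : ℕ}
    (h : ∀ j, j < M → a (M - 1 - j) = -a j) : ∑ j ∈ Finset.range M, a j = 0 := by
  have h1 := Finset.sum_range_reflect a M
  rw [Finset.sum_congr rfl fun j hj => h j (Finset.mem_range.1 hj), Finset.sum_neg_distrib] at h1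
  exact self_eq_neg.1 h1.symm

theorem sum_range_sub_of_antisymm [CharZero L] {a : ℕ → L} {M : ℕ}
    (h : ∀ j, j < M → a (M - 1 - j) = -a j) {k : ℕ} (hk : k ≤ M) :
    ∑ j ∈ Finset.range (M - k), a j = ∑ j ∈ Finset.range k, a j := by
  induction k with
  | zero => simpa using sum_range_eq_zero_of_antisymm h
  | succ k ih =>
    have h1 := ih (by omega)
    have h2 := h k (by omega)
    rw [show M - k = M - (k + 1) + 1 by omega, Finset.sum_range_succ,
      show M - (k + 1) = M - 1 - k by omega, h2] at h1
    rw [show M - (k + 1) = M - 1 - k by omega, Finset.sum_range_succ, ← h1]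
    ring

theorem prod_range_sub_of_reflect {ζ : L} {g : ℕ → L} {M : ℕ}
    (h : ∀ j, j < M → ζ * g j * g (M - 1 - j) = 1) {k : ℕ} (hk : k ≤ M) :
    ∏ j ∈ Finset.range (M - k), g j =
      ζ ^ k * (∏ j ∈ Finset.range M, g j) * ∏ j ∈ Finset.range k, g j := by
  induction k with
  | zero => simp
  | succ k ih =>
    have h1 := ih (by omega)
    have h2 := h k (by omega)
    rw [show M - k = M - (k + 1) + 1 by omega, Finset.prod_range_succ,
      show M - (k + 1) = M - 1 - k by omega] at h1
    rw [show M - (k + 1) = M - 1 - k by omega, Finset.prod_range_succ]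
    linear_combination ζ * g k * h1 - (∏ j ∈ Finset.range (M - 1 - k), g j) * h2

/-- If `ζ g_j g_{M-1-j} = 1` and `ζ^{2M+c} = 1`, then `(1 - ζ^{4k+c}) (g_0 ⋯ g_{k-1})^4` changes
sign under `k ↦ M - k`. -/
theorem antisymm_of_reflect {ζ : L} {g : ℕ → L} {M c : ℕ} (hζ : ζ ^ (2 * M + c) = 1)
    (h : ∀ j, j < M → ζ * g j * g (M - 1 - j) = 1) {k : ℕ} (hk : k ≤ M) :
    (1 - ζ ^ (4 * (M - k) + c)) * (∏ j ∈ Finset.range (M - k), g j) ^ 4 =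
      -((1 - ζ ^ (4 * k + c)) * (∏ j ∈ Finset.range k, g j) ^ 4) := by
  have hM := prod_range_sub_of_reflect h le_rfl
  rw [Nat.sub_self, Finset.prod_range_zero] at hM
  rw [prod_range_sub_of_reflect h hk]
  -- The reflection formula at k = M reads 1 = ζ^M P², which determines P⁴ as ζ^c.
  generalize ∏ j ∈ Finset.range M, g j = P at *
  generalize ∏ j ∈ Finset.range k, g j = Q
  have h1 : ζ ^ (2 * M) * P ^ 4 = 1 := by
    calc ζ ^ (2 * M) * P ^ 4 = (ζ ^ M * P * P) ^ 2 := by ring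
      _ = 1 := by rw [← hM, one_pow]
  have h2 : P ^ 4 = ζ ^ c := by
    calc P ^ 4 = ζ ^ (2 * M + c) * P ^ 4 := by rw [hζ, one_mul]
      _ = ζ ^ c * (ζ ^ (2 * M) * P ^ 4) := by ring
      _ = _ := by rw [h1, mul_one]
  have h3 : ζ ^ (4 * (M - k) + c) * ζ ^ (4 * k + c) = 1 := by
    rw [← pow_add, show 4 * (M - k) + c + (4 * k + c) = (2 * M + c) * 2 by omega, pow_mul, hζ,
      one_pow]
  calc _ = (1 - ζ ^ (4 * (M - k) + c)) * (ζ ^ (4 * k) * P ^ 4 * Q ^ 4) := by ring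
    _ = (1 - ζ ^ (4 * (M - k) + c)) * (ζ ^ (4 * k + c) * Q ^ 4) := by
      rw [h2, pow_add _ (4 * k)]
    _ = _ := by linear_combination -Q ^ 4 * h3

end Reflection

/-! ### Identities at a root of unity -/

section RootOfUnity

variable {L : Type*} [Field L] {ζ : L} {n m : ℕ}

theorem one_sub_pow_ne_zero (hζ : IsPrimitiveRoot ζ n) {j : ℕ} (hj : ¬ n ∣ j) :
    1 - ζ ^ j ≠ 0 := fun h => hj (hζ.dvd_of_pow_eq_one j (sub_eq_zero.1 h).symm)

theorem one_sub_pow_ne_zero_of_lt (hζ : IsPrimitiveRoot ζ n) {j : ℕ} (h0 : 0 < j) (hj : j < n) :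
    1 - ζ ^ j ≠ 0 := one_sub_pow_ne_zero hζ (Nat.not_dvd_of_pos_of_lt h0 hj)

/-- Since ζ^b and ζ^{b+1} are the inverses of ζ^{a+1} and ζ^a, the two fractions are reciprocal up
to the factor ζ. -/
theorem div_mul_div_eq_one_of_reflect {a b : ℕ} (hζ : IsPrimitiveRoot ζ n) (ha : 0 < a)
    (hb : 0 < b) (hab : a + 1 + b = n) :
    ζ * ((1 - ζ ^ a) / (1 - ζ ^ (a + 1))) * ((1 - ζ ^ b) / (1 - ζ ^ (b + 1))) = 1 := by
  have h1 := one_sub_pow_ne_zero_of_lt hζ (j := a + 1) (by omega) (by omega)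
  have h2 := one_sub_pow_ne_zero_of_lt hζ (j := b + 1) (by omega) (by omega)
  have h3 : ζ * ζ ^ a * ζ ^ b = 1 := by rw [← hζ.pow_eq_one, ← hab]; ring
  rw [mul_assoc, div_mul_div_comm, mul_div_assoc', div_eq_one_iff_eq (mul_ne_zero h1 h2)]
  rw [pow_succ, pow_succ]
  linear_combination (1 - ζ) * h3

theorem theta_root_antisymm (hζ : IsPrimitiveRoot ζ n) (hn : n = 2 * m + 1) {k : ℕ}
    (hk : k ≤ m) :
    (1 - ζ ^ (4 * (m - k) + 1)) * wpRatio ζ 1 (m - k) ^ 4 =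
      -((1 - ζ ^ (4 * k + 1)) * wpRatio ζ 1 k ^ 4) := by
  refine antisymm_of_reflect (by rw [← hn, hζ.pow_eq_one]) (fun j hj => ?_) hk
  rw [one_mul, one_mul]
  exact div_mul_div_eq_one_of_reflect hζ (by omega) (by omega) (by omega)

theorem theta_root_tail_antisymm (hζ : IsPrimitiveRoot ζ n) (hn : n = 2 * m + 1) {u : ℕ}
    (hu : u < m) :
    (1 - ζ ^ (4 * (m - 1 - u) + 3)) *
        (∏ j ∈ Finset.range (m - 1 - u), (1 - ζ ^ (2 * j + 2)) / (1 - ζ ^ (2 * j + 3))) ^ 4 =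
      -((1 - ζ ^ (4 * u + 3)) *
        (∏ j ∈ Finset.range u, (1 - ζ ^ (2 * j + 2)) / (1 - ζ ^ (2 * j + 3))) ^ 4) := by
  refine antisymm_of_reflect (by
    rw [show 2 * (m - 1) + 3 = n by omega, hζ.pow_eq_one]) (fun j hj => ?_) (by omega)
  exact div_mul_div_eq_one_of_reflect hζ (by omega) (by omega) (by omega)

/-- The sum `∑_{j<k} (1 / (1 - q^{2j+1}) + q^{2j+2} / (1 - q^{2j+2}))`. -/
def logSum (q : L) (k : ℕ) : L :=
  ∑ j ∈ Finset.range k, (1 / (1 - q ^ (2 * j + 1)) + q ^ (2 * j + 2) / (1 - q ^ (2 * j + 2)))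

/-- The summand changes sign under j ↦ m-1-j, because 1/(1-x) + y/(1-y) = 0 whenever xy = 1. -/
theorem logSum_reflect [CharZero L] (hζ : IsPrimitiveRoot ζ n) (hn : n = 2 * m + 1) {k : ℕ}
    (hk : k ≤ m) : logSum ζ (m - k) = logSum ζ k := by
  refine sum_range_sub_of_antisymm (fun j hj => ?_) hk
  have h1 := one_sub_pow_ne_zero_of_lt hζ (j := 2 * j + 1) (by omega) (by omega)
  have h2 := one_sub_pow_ne_zero_of_lt hζ (j := 2 * j + 2) (by omega) (by omega)
  have h3 := one_sub_pow_ne_zero_of_lt hζ (j := 2 * (m - 1 - j) + 1) (by omega) (by omega)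
  have h4 := one_sub_pow_ne_zero_of_lt hζ (j := 2 * (m - 1 - j) + 2) (by omega) (by omega)
  have e1 : ζ ^ (2 * (m - 1 - j) + 1) * ζ ^ (2 * j + 2) = 1 := by
    rw [← hζ.pow_eq_one, ← pow_add]; congr 1; omega
  have e2 : ζ ^ (2 * (m - 1 - j) + 2) * ζ ^ (2 * j + 1) = 1 := by
    rw [← hζ.pow_eq_one, ← pow_add]; congr 1; omega
  generalize ζ ^ (2 * (m - 1 - j) + 1) = a at *
  generalize ζ ^ (2 * (m - 1 - j) + 2) = b at *
  generalize ζ ^ (2 * j + 1) = c at *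
  generalize ζ ^ (2 * j + 2) = d at *
  have f1 : 1 / (1 - a) + d / (1 - d) = 0 := by
    rw [div_add_div _ _ h3 h2, div_eq_zero_iff]; left; linear_combination -e1
  have f2 : b / (1 - b) + 1 / (1 - c) = 0 := by
    rw [div_add_div _ _ h4 h1, div_eq_zero_iff]; left; linear_combination -e2
  linear_combination f1 + f2

theorem sum_theta_root (hζ : IsPrimitiveRoot ζ n) (hn : n = 2 * m + 1) [CharZero L] :
    ∑ k ∈ Finset.range (m + 1), (1 - ζ ^ (4 * k + 1)) * wpRatio ζ 1 k ^ 4 = 0 :=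
  sum_range_eq_zero_of_antisymm fun j hj => by
    rw [Nat.add_sub_cancel]; exact theta_root_antisymm hζ hn (by omega)

theorem sum_theta_root_mul_logSum (hζ : IsPrimitiveRoot ζ n) (hn : n = 2 * m + 1) [CharZero L] :
    ∑ k ∈ Finset.range (m + 1),
      (1 - ζ ^ (4 * k + 1)) * wpRatio ζ 1 k ^ 4 * logSum ζ k ^ 3 = 0 :=
  sum_range_eq_zero_of_antisymm fun j hj => by
    rw [Nat.add_sub_cancel, theta_root_antisymm hζ hn (by omega),
      logSum_reflect hζ hn (by omega)]
    ring

/-- Under u ↦ m-1-u the outer factor changes sign, while the inner partial sum is unchanged: the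
full sum over k ≤ m is zero and antisymmetric, so its first m - u and first u + 1 terms have the
same sum. -/
theorem sum_tail_root (hζ : IsPrimitiveRoot ζ n) (hn : n = 2 * m + 1) [CharZero L] :
    ∑ u ∈ Finset.range m, (1 - ζ ^ (4 * u + 3)) *
        (∏ j ∈ Finset.range u, (1 - ζ ^ (2 * j + 2)) / (1 - ζ ^ (2 * j + 3))) ^ 4 *
        ∑ k ∈ Finset.range (m - u), (1 - ζ ^ (4 * k + 1)) * wpRatio ζ 1 k ^ 4 = 0 :=
  sum_range_eq_zero_of_antisymm fun u hu => by
    have h := sum_range_sub_of_antisymm (M := m + 1)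
      (a := fun k => (1 - ζ ^ (4 * k + 1)) * wpRatio ζ 1 k ^ 4) (fun j hj => by
        rw [Nat.add_sub_cancel]; exact theta_root_antisymm hζ hn (by omega))
      (k := u + 1) (by omega)
    rw [theta_root_tail_antisymm hζ hn hu, show m - (m - 1 - u) = u + 1 by omega, ← h,
      show m + 1 - (u + 1) = m - u by omega]
    ring

end RootOfUnity

/-! ### Values of rational functions at a point -/

section Value

variable {L : Type*} [Field L] {ζ : L} {f g : RatFunc ℤ} {z w : L}

/-- The rational function `f` is regular at `ζ`, with value `z`. -/
def HasValue (ζ : L) (f : RatFunc ℤ) (z : L) : Prop :=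
  ∃ a b : ℤ[X], aeval ζ b ≠ 0 ∧ f * algebraMap ℤ[X] (RatFunc ℤ) b = algebraMap ℤ[X] (RatFunc ℤ) a ∧
    z * aeval ζ b = aeval ζ a

theorem HasValue.polynomial (ζ : L) (p : ℤ[X]) :
    HasValue ζ (algebraMap ℤ[X] (RatFunc ℤ) p) (aeval ζ p) :=
  ⟨p, 1, by simp, by simp, by simp⟩

theorem HasValue.indeterminate (ζ : L) : HasValue ζ q ζ := by
  simpa using HasValue.polynomial ζ Polynomial.X

theorem HasValue.natCast (ζ : L) (k : ℕ) : HasValue ζ (k : RatFunc ℤ) (k : L) := by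
  simpa using HasValue.polynomial ζ (k : ℤ[X])

theorem HasValue.one (ζ : L) : HasValue ζ 1 1 := by simpa using HasValue.natCast ζ 1

theorem HasValue.zero (ζ : L) : HasValue ζ 0 0 := by simpa using HasValue.natCast ζ 0

theorem HasValue.two (ζ : L) : HasValue ζ 2 2 := by simpa using HasValue.natCast ζ 2

theorem HasValue.add (hf : HasValue ζ f z) (hg : HasValue ζ g w) : HasValue ζ (f + g) (z + w) := by
  obtain ⟨a, b, h1, h2, h3⟩ := hf
  obtain ⟨c, d, k1, k2, k3⟩ := hg
  refine ⟨a * d + c * b, b * d, ?_, ?_, ?_⟩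
  · rw [map_mul]; exact mul_ne_zero h1 k1
  · simp only [map_add, map_mul, ← h2, ← k2]; ring
  · simp only [map_add, map_mul, ← h3, ← k3]; ring

theorem HasValue.mul (hf : HasValue ζ f z) (hg : HasValue ζ g w) : HasValue ζ (f * g) (z * w) := by
  obtain ⟨a, b, h1, h2, h3⟩ := hf
  obtain ⟨c, d, k1, k2, k3⟩ := hg
  refine ⟨a * c, b * d, ?_, ?_, ?_⟩
  · rw [map_mul]; exact mul_ne_zero h1 k1
  · simp only [map_mul, ← h2, ← k2]; ring
  · simp only [map_mul, ← h3, ← k3]; ring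

theorem HasValue.neg (hf : HasValue ζ f z) : HasValue ζ (-f) (-z) := by
  obtain ⟨a, b, h1, h2, h3⟩ := hf
  exact ⟨-a, b, h1, by rw [map_neg, ← h2, neg_mul], by rw [map_neg, ← h3, neg_mul]⟩

theorem HasValue.sub (hf : HasValue ζ f z) (hg : HasValue ζ g w) : HasValue ζ (f - g) (z - w) := by
  simpa [sub_eq_add_neg] using hf.add hg.neg

theorem HasValue.pow (hf : HasValue ζ f z) (k : ℕ) : HasValue ζ (f ^ k) (z ^ k) := by
  induction k with
  | zero => simpa using HasValue.one ζ
  | succ k ih => simpa [pow_succ] using ih.mul hf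

theorem HasValue.sum {ι : Type*} {s : Finset ι} {f : ι → RatFunc ℤ} {z : ι → L}
    (h : ∀ i ∈ s, HasValue ζ (f i) (z i)) : HasValue ζ (∑ i ∈ s, f i) (∑ i ∈ s, z i) := by
  classical
  induction s using Finset.induction_on with
  | empty => simpa using HasValue.zero ζ
  | insert i s hi ih =>
    rw [Finset.sum_insert hi, Finset.sum_insert hi]
    exact (h i (Finset.mem_insert_self i s)).add
      (ih fun j hj => h j (Finset.mem_insert_of_mem hj))

theorem HasValue.prod {ι : Type*} {s : Finset ι} {f : ι → RatFunc ℤ} {z : ι → L}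
    (h : ∀ i ∈ s, HasValue ζ (f i) (z i)) : HasValue ζ (∏ i ∈ s, f i) (∏ i ∈ s, z i) := by
  classical
  induction s using Finset.induction_on with
  | empty => simpa using HasValue.one ζ
  | insert i s hi ih =>
    rw [Finset.prod_insert hi, Finset.prod_insert hi]
    exact (h i (Finset.mem_insert_self i s)).mul
      (ih fun j hj => h j (Finset.mem_insert_of_mem hj))

theorem algebraMap_ne_zero_of_aeval {b : ℤ[X]} (h : aeval ζ b ≠ 0) :
    algebraMap ℤ[X] (RatFunc ℤ) b ≠ 0 := fun h0 => h (by
  rw [(map_eq_zero_iff _ (RatFunc.algebraMap_injective ℤ)).1 h0, map_zero])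

theorem HasValue.inv (hf : HasValue ζ f z) (hz : z ≠ 0) : HasValue ζ f⁻¹ z⁻¹ := by
  obtain ⟨a, b, h1, h2, h3⟩ := hf
  have ha : aeval ζ a ≠ 0 := h3 ▸ mul_ne_zero hz h1
  have hf0 : f ≠ 0 := fun h => algebraMap_ne_zero_of_aeval ha (by rw [← h2, h, zero_mul])
  refine ⟨b, a, ha, ?_, ?_⟩
  · rw [← h2, inv_mul_cancel_left₀ hf0]
  · rw [← h3, inv_mul_cancel_left₀ hz]

theorem HasValue.div (hf : HasValue ζ f z) (hg : HasValue ζ g w) (hw : w ≠ 0) :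
    HasValue ζ (f / g) (z / w) := by
  simpa [div_eq_mul_inv] using hf.mul (hg.inv hw)

theorem HasValue.congr (hf : HasValue ζ f z) (h : z = w) : HasValue ζ f w := h ▸ hf

theorem HasValue.one_sub_pow (ζ : L) (k : ℕ) : HasValue ζ (1 - q ^ k) (1 - ζ ^ k) :=
  (HasValue.one ζ).sub ((HasValue.indeterminate ζ).pow k)

theorem HasValue.wp {y : RatFunc ℤ} {η : L} (hy : HasValue ζ y η) {k : ℕ}
    (h : ∀ j, j < k → 1 - η * ζ ^ (2 * j + 2) ≠ 0) :
    HasValue ζ (wpRatio q y k) (wpRatio ζ η k) :=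
  HasValue.prod fun j hj => (hy.sub ((HasValue.indeterminate ζ).pow _)).div
    ((HasValue.one ζ).sub (hy.mul ((HasValue.indeterminate ζ).pow _))) (h j (Finset.mem_range.1 hj))

/-- The ring of rational functions regular at `ζ`. -/
def regularRing (ζ : L) : Subring (RatFunc ℤ) where
  carrier := {f | ∃ z, HasValue ζ f z}
  mul_mem' := fun ⟨z, hz⟩ ⟨w, hw⟩ => ⟨z * w, hz.mul hw⟩
  one_mem' := ⟨1, HasValue.one ζ⟩
  add_mem' := fun ⟨z, hz⟩ ⟨w, hw⟩ => ⟨z + w, hz.add hw⟩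
  zero_mem' := ⟨0, HasValue.zero ζ⟩
  neg_mem' := fun ⟨z, hz⟩ => ⟨-z, hz.neg⟩

theorem mem_regularRing : f ∈ regularRing ζ ↔ ∃ z, HasValue ζ f z := Iff.rfl

theorem HasValue.mem (hf : HasValue ζ f z) : f ∈ regularRing ζ := ⟨z, hf⟩

theorem HasValue.zero_mul_mem (hf : HasValue ζ f 0) (hg : g ∈ regularRing ζ) :
    HasValue ζ (f * g) 0 := by
  obtain ⟨w, hw⟩ := hg
  simpa using hf.mul hw

variable [CharZero L] {n : ℕ}

theorem cyclotomic_dvd_of_aeval_eq_zero (hn : 0 < n) (hζ : IsPrimitiveRoot ζ n) {a : ℤ[X]}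
    (ha : aeval ζ a = 0) : cyclotomic n ℤ ∣ a := by
  rw [cyclotomic_eq_minpoly hζ hn]
  exact minpoly.isIntegrallyClosed_dvd (hζ.isIntegral hn) ha

theorem aeval_cyclotomic (hn : 0 < n) (hζ : IsPrimitiveRoot ζ n) :
    aeval ζ (cyclotomic n ℤ) = 0 := by
  rw [cyclotomic_eq_minpoly hζ hn, minpoly.aeval]

theorem HasValue.exists_eq_cyclotomic_mul (hn : 0 < n) (hζ : IsPrimitiveRoot ζ n)
    (hf : HasValue ζ f 0) :
    ∃ g ∈ regularRing ζ, f = algebraMap ℤ[X] (RatFunc ℤ) (cyclotomic n ℤ) * g := by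
  obtain ⟨a, b, h1, h2, h3⟩ := hf
  rw [zero_mul] at h3
  obtain ⟨c, rfl⟩ := cyclotomic_dvd_of_aeval_eq_zero hn hζ h3.symm
  have hb := algebraMap_ne_zero_of_aeval h1
  refine ⟨algebraMap ℤ[X] (RatFunc ℤ) c / algebraMap ℤ[X] (RatFunc ℤ) b,
    ((HasValue.polynomial ζ c).div (HasValue.polynomial ζ b) h1).mem, ?_⟩
  rw [mul_div_assoc', ← map_mul, ← h2, mul_div_cancel_right₀ _ hb]

/-- Writing g = a/b with b(ζ) ≠ 0 gives num · b = Φ_n^k · a · den, and the prime Φ_n does not divide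
b. -/
theorem cyclotomic_pow_dvd_num (hn : 0 < n) (hζ : IsPrimitiveRoot ζ n) {k : ℕ}
    (hg : g ∈ regularRing ζ)
    (hf : f = algebraMap ℤ[X] (RatFunc ℤ) (cyclotomic n ℤ) ^ k * g) :
    cyclotomic n ℤ ^ k ∣ IsFractionRing.num ℤ[X] f := by
  obtain ⟨z, a, b, h1, h2, -⟩ := hg
  refine (cyclotomic.irreducible hn).prime.pow_dvd_of_dvd_mul_right k (b := b) (fun h => h1 ?_) ?_
  · obtain ⟨c, rfl⟩ := h
    rw [map_mul, aeval_cyclotomic hn hζ, zero_mul]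
  · refine ⟨a * (IsFractionRing.den ℤ[X] f : ℤ[X]), RatFunc.algebraMap_injective ℤ ?_⟩
    have hd : algebraMap ℤ[X] (RatFunc ℤ) (IsFractionRing.den ℤ[X] f : ℤ[X]) ≠ 0 :=
      IsFractionRing.to_map_ne_zero_of_mem_nonZeroDivisors (IsFractionRing.den ℤ[X] f).2
    have h3 := IsFractionRing.mk'_num_den' ℤ[X] f
    rw [div_eq_iff hd] at h3
    simp only [map_mul, map_pow, h3, ← h2]
    nth_rw 1 [hf]
    ring

end Value

/-! ### Nonvanishing in the function field, and θ_q in terms of `wpRatio` -/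

theorem q_ne_zero : q ≠ 0 := by
  intro h
  have h1 : algebraMap ℤ[X] (RatFunc ℤ) X = 0 := by simpa using h
  exact X_ne_zero ((map_eq_zero_iff _ (RatFunc.algebraMap_injective ℤ)).1 h1)

theorem one_sub_q_pow_ne_zero {k : ℕ} (hk : 0 < k) : 1 - q ^ k ≠ 0 := by
  intro h
  have h1 : algebraMap ℤ[X] (RatFunc ℤ) (1 - X ^ k) = 0 := by simpa using h
  have h2 := (map_eq_zero_iff _ (RatFunc.algebraMap_injective ℤ)).1 h1
  have h3 := congrArg (eval 0) h2
  simp [hk.ne'] at h3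

theorem one_sub_q_ne_zero : 1 - q ≠ 0 := by simpa using one_sub_q_pow_ne_zero (k := 1) one_pos

theorem wpRatio_q_one (k : ℕ) :
    wpRatio q 1 k = qPoch q (q ^ 2) k / qPoch (q ^ 2) (q ^ 2) k := by
  rw [wpRatio, qPoch, qPoch, ← Finset.prod_div_distrib]
  refine Finset.prod_congr rfl fun j _ => ?_
  congr 2 <;> ring

theorem theta_eq (k : ℕ) : theta k = (1 - q ^ (4 * k + 1)) * wpRatio q 1 k ^ 4 / (1 - q) := by
  rw [theta, qInt, wpRatio_q_one]; ring


/-! ### The single sum modulo the fourth power of a cyclotomic polynomial -/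

section SpecialValues

variable {K : Type*} [Field K] {q : K}

theorem prod_q_pow_even (q : K) (m : ℕ) :
    ∏ j ∈ Finset.range m, q ^ (2 * j + 2) = q ^ (m * (m + 1)) := by
  induction m with
  | zero => simp
  | succ m ih => rw [Finset.prod_range_succ, ih, ← pow_add]; congr 1; ring

/-- After reversing the product, each factor is 1 - y q^{2m+1}/s with s = q^{2j+2}, and -(1-s)/s is
pulled out of it. What remains is 1 minus a multiple of 1 - y q^{2m+1}, ready for expansion in e. -/
theorem prod_one_sub_odd_reflect (hq0 : q ≠ 0) (hq : ∀ j : ℕ, 1 - q ^ (j + 1) ≠ 0) (y : K)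
    (m : ℕ) :
    ∏ j ∈ Finset.range m, (1 - y * q ^ (2 * j + 1)) =
      (∏ j ∈ Finset.range m, -(1 - q ^ (2 * j + 2)) / q ^ (2 * j + 2)) *
        ∏ j ∈ Finset.range m, (1 - (1 - y * q ^ (2 * m + 1)) * (1 / (1 - q ^ (2 * j + 2)))) := by
  rw [← Finset.prod_range_reflect, ← Finset.prod_mul_distrib]
  refine Finset.prod_congr rfl fun j hj => ?_
  have hj := Finset.mem_range.1 hj
  have h1 := hq (2 * j + 1)
  have h2 : q ^ (2 * j + 2) ≠ 0 := pow_ne_zero _ hq0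
  have h3 : q ^ (2 * m + 1) = q ^ (2 * (m - 1 - j) + 1) * q ^ (2 * j + 2) := by
    rw [← pow_add]; congr 1; omega
  rw [h3]
  change 1 - q ^ (2 * j + 2) ≠ 0 at h1
  generalize q ^ (2 * j + 2) = s at *
  field_simp
  ring

theorem one_sub_mul_prod_odd (q : K) (m : ℕ) :
    (1 - q) * ∏ j ∈ Finset.range m, (1 - q ^ (2 * j + 3)) =
      (1 - q ^ (2 * m + 1)) * ∏ j ∈ Finset.range m, (1 - q ^ (2 * j + 1)) := by
  induction m with
  | zero => simp
  | succ m ih =>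
    rw [Finset.prod_range_succ, Finset.prod_range_succ]
    linear_combination (1 - q ^ (2 * m + 3)) * ih

theorem prod_one_sub_mul_even (hq : ∀ j : ℕ, 1 - q ^ (j + 1) ≠ 0) (E : K) (m : ℕ) :
    ∏ j ∈ Finset.range m, (1 - E * q ^ (2 * j + 2)) =
      (∏ j ∈ Finset.range m, (1 - q ^ (2 * j + 2))) *
        ∏ j ∈ Finset.range m, (1 + (1 - E) * (1 / (1 - q ^ (2 * j + 2)) - 1)) := by
  rw [← Finset.prod_mul_distrib]
  refine Finset.prod_congr rfl fun j _ => ?_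
  have h1 : 1 - q ^ (2 * j + 2) ≠ 0 := hq (2 * j + 1)
  generalize q ^ (2 * j + 2) = s at *
  field_simp
  ring

theorem sum_wp_eq (hq0 : q ≠ 0) (hq : ∀ j : ℕ, 1 - q ^ (j + 1) ≠ 0) {y z : K}
    (hy : ∀ j : ℕ, 1 - y * q ^ (2 * j + 2) ≠ 0) (hz : ∀ j : ℕ, 1 - z * q ^ (2 * j + 2) ≠ 0)
    (m : ℕ) :
    ∑ k ∈ Finset.range (m + 1), (1 - q ^ (4 * k + 1)) * wpRatio q 1 k *
        wpRatio q (q ^ (2 * m + 1)) k * wpRatio q y k * wpRatio q z k =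
      (1 - q ^ (2 * m + 1)) / (q ^ (m * (m + 1))) ^ 2 *
        ((∏ j ∈ Finset.range m, (1 - (1 - q ^ (2 * m + 1)) * (1 / (1 - q ^ (2 * j + 2))))) *
        ∏ j ∈ Finset.range m, (1 - (1 - y * z * q ^ (2 * m + 1)) * (1 / (1 - q ^ (2 * j + 2))))) /
        ((∏ j ∈ Finset.range m, (1 + (1 - y) * (1 / (1 - q ^ (2 * j + 2)) - 1))) *
          ∏ j ∈ Finset.range m, (1 + (1 - z) * (1 / (1 - q ^ (2 * j + 2)) - 1))) := by
  have hB : ∏ j ∈ Finset.range m, (1 - q ^ (2 * j + 2)) ≠ 0 :=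
    Finset.prod_ne_zero_iff.2 fun j _ => hq (2 * j + 1)
  have hc : (∏ j ∈ Finset.range m, -(1 - q ^ (2 * j + 2)) / q ^ (2 * j + 2)) ^ 2 =
      (∏ j ∈ Finset.range m, (1 - q ^ (2 * j + 2))) ^ 2 / (q ^ (m * (m + 1))) ^ 2 := by
    rw [← prod_q_pow_even, ← div_pow, ← Finset.prod_div_distrib, ← Finset.prod_pow,
      ← Finset.prod_pow]
    exact Finset.prod_congr rfl fun j _ => by rw [neg_div, neg_sq]
  have h1 := prod_one_sub_odd_reflect hq0 hq 1 m
  simp only [one_mul] at h1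
  rw [sum_wp hq0 hq hy hz, Finset.prod_div_distrib, Finset.prod_mul_distrib,
    Finset.prod_mul_distrib, mul_div_assoc', ← mul_assoc, one_sub_mul_prod_odd, h1,
    prod_one_sub_odd_reflect hq0 hq (y * z), prod_one_sub_mul_even hq y,
    prod_one_sub_mul_even hq z]
  generalize ∏ j ∈ Finset.range m, -(1 - q ^ (2 * j + 2)) / q ^ (2 * j + 2) = c at *
  generalize ∏ j ∈ Finset.range m, (1 - q ^ (2 * j + 2)) = B at *
  have hQ : (q ^ (m * (m + 1))) ^ 2 ≠ 0 := pow_ne_zero _ (pow_ne_zero _ hq0)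
  rw [eq_div_iff hQ] at hc
  generalize (q ^ (m * (m + 1))) ^ 2 = Q at *
  generalize ∏ j ∈ Finset.range m, (1 - (1 - q ^ (2 * m + 1)) * (1 / (1 - q ^ (2 * j + 2)))) = P1
  generalize ∏ j ∈ Finset.range m,
    (1 - (1 - y * z * q ^ (2 * m + 1)) * (1 / (1 - q ^ (2 * j + 2)))) = P2
  generalize ∏ j ∈ Finset.range m, (1 + (1 - y) * (1 / (1 - q ^ (2 * j + 2)) - 1)) = D1
  generalize ∏ j ∈ Finset.range m, (1 + (1 - z) * (1 / (1 - q ^ (2 * j + 2)) - 1)) = D2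
  calc _ = (1 - q ^ (2 * m + 1)) * (P1 * P2) / (D1 * D2) * (c ^ 2 / B ^ 2) := by ring
    _ = (1 - q ^ (2 * m + 1)) * (P1 * P2) / (D1 * D2) * (1 / Q) := by
      congr 1
      rw [div_eq_div_iff (pow_ne_zero _ hB) hQ, hc, one_mul]
    _ = _ := by ring

end SpecialValues

section SingleSum

variable {L : Type*} [Field L] {ζ : L} {n m : ℕ}

theorem one_sub_q_pow_mul_ne_zero (i j : ℕ) : 1 - q ^ i * q ^ (2 * j + 2) ≠ 0 := by
  rw [← pow_add]; exact one_sub_q_pow_ne_zero (by omega)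

theorem one_sub_one_mul_q_pow_ne_zero (j : ℕ) : 1 - 1 * q ^ (2 * j + 2) ≠ 0 := by
  rw [one_mul]; exact one_sub_q_pow_ne_zero (by omega)

theorem HasValue.one_sub_q_pow_order (hζ : IsPrimitiveRoot ζ n) : HasValue ζ (1 - q ^ n) 0 :=
  (HasValue.one_sub_pow ζ n).congr (by rw [hζ.pow_eq_one, sub_self])

theorem hasValue_wpRatio_one (hζ : IsPrimitiveRoot ζ n) (hn : n = 2 * m + 1) {k : ℕ}
    (hk : k < n) : HasValue ζ (wpRatio q 1 k) (wpRatio ζ 1 k) :=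
  (HasValue.one ζ).wp fun j hj => by
    rw [one_mul]
    refine one_sub_pow_ne_zero hζ fun h => ?_
    have h2 : n.Coprime 2 := by rw [hn]; simp
    have := Nat.le_of_dvd (by omega) (h2.dvd_of_dvd_mul_left (show n ∣ 2 * (j + 1) from h))
    omega

theorem hasValue_wpRatio_order (hζ : IsPrimitiveRoot ζ n) (hn : n = 2 * m + 1) {k : ℕ}
    (hk : k ≤ m) : HasValue ζ (wpRatio q (q ^ n) k) (wpRatio ζ 1 k) :=
  (((HasValue.indeterminate ζ).pow n).congr hζ.pow_eq_one).wp fun j hj => by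
    rw [one_mul]; exact one_sub_pow_ne_zero_of_lt hζ (by omega) (by omega)

/-- A first-order expansion at y = 1: `logSum` is the logarithmic derivative of `wpRatio` in y
there. -/
theorem exists_wpRatio_sub (hζ : IsPrimitiveRoot ζ n) (hn : n = 2 * m + 1) {k : ℕ} (hk : k ≤ m) :
    ∃ v, HasValue ζ v (wpRatio ζ 1 k * logSum ζ k) ∧
      wpRatio q 1 k - wpRatio q (q ^ n) k = (1 - q ^ n) * v := by
  induction k with
  | zero => exact ⟨0, by simpa [logSum] using HasValue.zero ζ, by simp [wpRatio_zero]⟩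
  | succ k ih =>
    obtain ⟨v, hv, hv'⟩ := ih (by omega)
    have ha : 1 - ζ ^ (2 * k + 1) ≠ 0 := one_sub_pow_ne_zero_of_lt hζ (by omega) (by omega)
    have hb : 1 - ζ ^ (2 * k + 2) ≠ 0 := one_sub_pow_ne_zero_of_lt hζ (by omega) (by omega)
    have hs := (HasValue.indeterminate ζ).pow (2 * k + 2)
    have hE := ((HasValue.indeterminate ζ).pow n).congr hζ.pow_eq_one
    have hA := HasValue.one_sub_pow ζ (2 * k + 1)
    have hB := HasValue.one_sub_pow ζ (2 * k + 2)
    refine ⟨v * ((1 - q ^ (2 * k + 1)) / (1 - q ^ (2 * k + 2))) + wpRatio q (q ^ n) k *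
      (((1 - q ^ (2 * k + 1)) * q ^ (2 * k + 2) + (1 - q ^ (2 * k + 2))) /
        ((1 - q ^ (2 * k + 2)) * (1 - q ^ n * q ^ (2 * k + 2)))),
      ((hv.mul (hA.div hB hb)).add ((hasValue_wpRatio_order hζ hn (by omega)).mul
        (((hA.mul hs).add hB).div (hB.mul ((HasValue.one ζ).sub (hE.mul hs)))
          (by rw [one_mul]; exact mul_ne_zero hb hb)))).congr ?_, ?_⟩
    · rw [wpRatio_succ, show logSum ζ (k + 1) = logSum ζ k + _ from Finset.sum_range_succ _ _]
      generalize logSum ζ k = l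
      generalize ζ ^ (2 * k + 1) = a at *
      generalize ζ ^ (2 * k + 2) = s at *
      rw [one_mul]
      field_simp
      ring
    · rw [wpRatio_succ, wpRatio_succ, one_mul]
      have h1 : 1 - q ^ (2 * k + 2) ≠ 0 := one_sub_q_pow_ne_zero (by omega)
      have h2 := one_sub_q_pow_mul_ne_zero n k
      generalize wpRatio q 1 k = A at *
      generalize wpRatio q (q ^ n) k = B at *
      generalize q ^ (2 * k + 1) = a at *
      generalize q ^ (2 * k + 2) = s at *
      generalize q ^ n = E at *
      have key : (1 - a) / (1 - s) - (E - a) / (1 - E * s) =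
          (1 - E) * (((1 - a) * s + (1 - s)) / ((1 - s) * (1 - E * s))) := by
        rw [div_sub_div _ _ h1 h2, mul_div_assoc']
        congr 1
        ring
      linear_combination (1 - a) / (1 - s) * hv' + B * key

theorem exists_sum_wp_cube [CharZero L] (hζ : IsPrimitiveRoot ζ n) (hn : n = 2 * m + 1) :
    ∃ h, HasValue ζ h 0 ∧ ∑ k ∈ Finset.range (m + 1), (1 - q ^ (4 * k + 1)) * wpRatio q 1 k *
      (wpRatio q 1 k - wpRatio q (q ^ n) k) ^ 3 = (1 - q ^ n) ^ 3 * h := by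
  choose! v hv hv' using fun k (hk : k ≤ m) => exists_wpRatio_sub hζ hn hk
  refine ⟨∑ k ∈ Finset.range (m + 1), (1 - q ^ (4 * k + 1)) * wpRatio q 1 k * v k ^ 3,
    (HasValue.sum (z := fun k => (1 - ζ ^ (4 * k + 1)) * wpRatio ζ 1 k *
      (wpRatio ζ 1 k * logSum ζ k) ^ 3) fun k hk => ?_).congr ?_, ?_⟩
  · have hk := Finset.mem_range.1 hk
    exact ((HasValue.one_sub_pow ζ _).mul (hasValue_wpRatio_one hζ hn (by omega))).mul
      ((hv k (by omega)).pow 3)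
  · rw [← sum_theta_root_mul_logSum hζ hn]
    exact Finset.sum_congr rfl fun k _ => by ring
  · rw [Finset.mul_sum]
    refine Finset.sum_congr rfl fun k hk => ?_
    rw [hv' k (by have := Finset.mem_range.1 hk; omega)]
    ring

theorem exists_prod_combination (e : RatFunc ℤ) (he : e ∈ regularRing ζ) (w : ℕ → RatFunc ℤ)
    (hw : ∀ i, i < m → w i ∈ regularRing ζ) :
    ∃ h ∈ regularRing ζ,
      2 * (3 * ∏ i ∈ Finset.range m, (1 - e * w i) ^ 2 * (1 + e * (w i - 1)) ^ 2 -
      3 * ∏ i ∈ Finset.range m,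
        (1 - e * w i) * (1 - (2 * e - e ^ 2) * w i) * (1 + e * (w i - 1)) +
      ∏ i ∈ Finset.range m, (1 - e * w i) * (1 - (3 * e - 3 * e ^ 2 + e ^ 3) * w i) -
      (∏ i ∈ Finset.range m, (1 - e) * (1 + e * (w i - 1)) ^ 2) *
        (1 - e ^ 2 * ∑ i ∈ Finset.range m, w i * (w i - 1))) = e ^ 3 * h := by
  -- The polynomial identity is applied inside the subring of functions regular at ζ, so that the
  -- quotient h is regular. The value 0 for i ≥ m is never used.
  let w' : ℕ → regularRing ζ := fun i => if hi : i < m then ⟨w i, hw i hi⟩ else 0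
  have hw' : ∀ i ∈ Finset.range m, (w' i : RatFunc ℤ) = w i := fun i hi => by
    simp [w', Finset.mem_range.1 hi]
  obtain ⟨h, hh⟩ := pow_three_dvd_prod_combination (⟨e, he⟩ : regularRing ζ) w' m
  refine ⟨h, h.2, ?_⟩
  have h2 := congrArg (regularRing ζ).subtype hh
  simp only [map_mul, map_sub, map_add, map_prod, map_sum, map_pow, map_ofNat, map_one,
    Subring.subtype_apply] at h2
  rw [← h2]
  refine congrArg (2 * ·) (congrArg₂ (· - ·) (congrArg₂ (· + ·) (congrArg₂ (· - ·)
    (congrArg (3 * ·) ?_) (congrArg (3 * ·) ?_)) ?_)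
    (congrArg₂ (· * ·) ?_ (congrArg (1 - e ^ 2 * ·) ?_)))
  · exact Finset.prod_congr rfl fun i hi => by rw [hw' i hi]
  · exact Finset.prod_congr rfl fun i hi => by rw [hw' i hi]
  · exact Finset.prod_congr rfl fun i hi => by rw [hw' i hi]
  · exact Finset.prod_congr rfl fun i hi => by rw [hw' i hi]
  · exact Finset.sum_congr rfl fun i hi => by rw [hw' i hi]

theorem exists_sum_theta [CharZero L] (hζ : IsPrimitiveRoot ζ n) (hn : n = 2 * m + 1) :
    ∃ h, HasValue ζ h 0 ∧
      ∑ k ∈ Finset.range (m + 1), (1 - q ^ (4 * k + 1)) * wpRatio q 1 k ^ 4 =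
        (1 - q ^ n) / q ^ m * (1 - (1 - q ^ n) ^ 2 *
          ∑ j ∈ Finset.range m, q ^ (2 * j + 2) / (1 - q ^ (2 * j + 2)) ^ 2) +
        (1 - q ^ n) ^ 3 * h := by
  have hq : ∀ j : ℕ, 1 - q ^ (j + 1) ≠ 0 := fun j => one_sub_q_pow_ne_zero (by omega)
  have hζ0 : ζ ≠ 0 := hζ.ne_zero (by omega)
  have he := HasValue.one_sub_q_pow_order hζ
  have hw : ∀ j, j < m → HasValue ζ (1 / (1 - q ^ (2 * j + 2))) (1 / (1 - ζ ^ (2 * j + 2))) :=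
    fun j hj => (HasValue.one ζ).div (HasValue.one_sub_pow ζ _)
      (one_sub_pow_ne_zero_of_lt hζ (by omega) (by omega))
  obtain ⟨h₁, hh₁, hcube⟩ := exists_sum_wp_cube hζ hn
  obtain ⟨h₂, hh₂, hcomb⟩ := exists_prod_combination (1 - q ^ n) he.mem
    (fun j => 1 / (1 - q ^ (2 * j + 2))) (fun j hj => (hw j hj).mem)
  have hD : HasValue ζ
      (∏ j ∈ Finset.range m, (1 + (1 - q ^ n) * (1 / (1 - q ^ (2 * j + 2)) - 1))) 1 :=
    (HasValue.prod fun j hj => (HasValue.one ζ).add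
      (he.mul ((hw j (Finset.mem_range.1 hj)).sub (HasValue.one ζ)))).congr (by simp)
  have hD0 : ∏ j ∈ Finset.range m, (1 + (1 - q ^ n) * (1 / (1 - q ^ (2 * j + 2)) - 1)) ≠ 0 := by
    have hB := prod_one_sub_mul_even hq (q ^ n) m
    intro h0
    rw [h0, mul_zero] at hB
    exact Finset.prod_ne_zero_iff.2 (fun j _ => one_sub_q_pow_mul_ne_zero n j) hB
  have hE : ∏ j ∈ Finset.range m, (1 - (1 - q ^ n)) = (q ^ n) ^ m := by simp
  -- The exponent is m(2m+1) - 2m(m+1) = -m.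
  have hQ : (q ^ n) ^ m / (q ^ (m * (m + 1))) ^ 2 = 1 / q ^ m := by
    rw [div_eq_div_iff (pow_ne_zero _ (pow_ne_zero _ q_ne_zero)) (pow_ne_zero _ q_ne_zero), hn]
    ring
  have hS : ∑ j ∈ Finset.range m, 1 / (1 - q ^ (2 * j + 2)) * (1 / (1 - q ^ (2 * j + 2)) - 1) =
      ∑ j ∈ Finset.range m, q ^ (2 * j + 2) / (1 - q ^ (2 * j + 2)) ^ 2 :=
    Finset.sum_congr rfl fun j _ => by
      have := hq (2 * j + 1)
      change 1 - q ^ (2 * j + 2) ≠ 0 at this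
      field_simp
      ring
  have hy1 := one_sub_one_mul_q_pow_ne_zero
  have hyE := one_sub_q_pow_mul_ne_zero n
  have g1 := sum_wp_eq q_ne_zero hq hy1 hy1 m
  have g2 := sum_wp_eq q_ne_zero hq hyE hy1 m
  have g3 := sum_wp_eq q_ne_zero hq hyE hyE m
  rw [← hn] at g1 g2 g3
  have c1 : (1 : RatFunc ℤ) - 1 * 1 * q ^ n = 1 - q ^ n := by ring
  have c2 : (1 : RatFunc ℤ) - q ^ n * 1 * q ^ n = 2 * (1 - q ^ n) - (1 - q ^ n) ^ 2 := by ring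
  have c3 : (1 : RatFunc ℤ) - q ^ n * q ^ n * q ^ n =
      3 * (1 - q ^ n) - 3 * (1 - q ^ n) ^ 2 + (1 - q ^ n) ^ 3 := by ring
  rw [c1] at g1
  rw [c2] at g2
  rw [c3] at g3
  simp only [sub_self, zero_mul, add_zero, Finset.prod_const_one, mul_one, div_one] at g1 g2
  simp only [Finset.prod_mul_distrib, Finset.prod_pow, hE, hS] at hcomb
  -- Apart from the fourth-power sum, every term of the expanded cube contains `wpRatio q (q ^ n) k`
  -- and is evaluated by g1, g2, g3.
  have hsum : ∑ k ∈ Finset.range (m + 1), (1 - q ^ (4 * k + 1)) * wpRatio q 1 k *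
      (wpRatio q 1 k - wpRatio q (q ^ n) k) ^ 3 =
      ∑ k ∈ Finset.range (m + 1), (1 - q ^ (4 * k + 1)) * wpRatio q 1 k ^ 4 -
      3 * ∑ k ∈ Finset.range (m + 1), (1 - q ^ (4 * k + 1)) * wpRatio q 1 k *
        wpRatio q (q ^ n) k * wpRatio q 1 k * wpRatio q 1 k +
      3 * ∑ k ∈ Finset.range (m + 1), (1 - q ^ (4 * k + 1)) * wpRatio q 1 k *
        wpRatio q (q ^ n) k * wpRatio q (q ^ n) k * wpRatio q 1 k -
      ∑ k ∈ Finset.range (m + 1), (1 - q ^ (4 * k + 1)) * wpRatio q 1 k *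
        wpRatio q (q ^ n) k * wpRatio q (q ^ n) k * wpRatio q (q ^ n) k := by
    simp only [Finset.mul_sum, ← Finset.sum_sub_distrib, ← Finset.sum_add_distrib]
    exact Finset.sum_congr rfl fun k _ => by ring
  rw [hcube, g1, g2, g3] at hsum
  have hQv := ((HasValue.indeterminate ζ).pow (m * (m + 1))).pow 2
  refine ⟨h₁ + (1 - q ^ n) * (h₂ / (2 * (q ^ (m * (m + 1))) ^ 2 *
      (∏ j ∈ Finset.range m, (1 + (1 - q ^ n) * (1 / (1 - q ^ (2 * j + 2)) - 1))) ^ 2)),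
    (hh₁.add (he.zero_mul_mem ?_)).congr (add_zero 0), ?_⟩
  · obtain ⟨z, hz⟩ := hh₂
    exact (hz.div (((HasValue.two ζ).mul hQv).mul (hD.pow 2)) (by
      rw [one_pow, mul_one]
      exact mul_ne_zero two_ne_zero (pow_ne_zero _ (pow_ne_zero _ hζ0)))).mem
  · have hQ0 : (q ^ (m * (m + 1))) ^ 2 ≠ 0 := pow_ne_zero _ (pow_ne_zero _ q_ne_zero)
    have hm0 : q ^ m ≠ 0 := pow_ne_zero _ q_ne_zero
    rw [div_eq_div_iff hQ0 hm0, one_mul] at hQ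
    generalize (q ^ (m * (m + 1))) ^ 2 = Q at *
    generalize (q ^ n) ^ m = R at *
    generalize q ^ m = T at *
    generalize ∏ j ∈ Finset.range m, (1 + (1 - q ^ n) * (1 / (1 - q ^ (2 * j + 2)) - 1)) = D at *
    generalize ∏ j ∈ Finset.range m, (1 - (1 - q ^ n) * (1 / (1 - q ^ (2 * j + 2)))) = P1 at *
    generalize ∏ j ∈ Finset.range m,
      (1 - (2 * (1 - q ^ n) - (1 - q ^ n) ^ 2) * (1 / (1 - q ^ (2 * j + 2)))) = P2 at *
    generalize ∏ j ∈ Finset.range m, (1 - (3 * (1 - q ^ n) - 3 * (1 - q ^ n) ^ 2 +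
      (1 - q ^ n) ^ 3) * (1 / (1 - q ^ (2 * j + 2)))) = P3 at *
    generalize ∑ j ∈ Finset.range m, q ^ (2 * j + 2) / (1 - q ^ (2 * j + 2)) ^ 2 = σ at *
    generalize ∑ k ∈ Finset.range (m + 1), (1 - q ^ (4 * k + 1)) * wpRatio q 1 k ^ 4 = S at *
    generalize 1 - q ^ n = e at *
    have h20 : (2 : RatFunc ℤ) ≠ 0 := by
      have h := algebraMap_ne_zero_of_aeval (ζ := (1 : ℚ)) (b := 2)
        (by rw [map_ofNat]; exact two_ne_zero)
      rwa [map_ofNat] at h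
    have hT : e / T = e * R / Q := by
      rw [div_eq_div_iff hm0 hQ0]; linear_combination -e * hQ
    have key : 3 * (e / Q * (P1 * P1)) - 3 * (e / Q * (P1 * P2) / D) + e / Q * (P1 * P3) / (D * D) =
        e * R / Q * (1 - e ^ 2 * σ) + e ^ 3 * (e * (h₂ / (2 * Q * D ^ 2))) := by
      have : e ^ 3 * (e * (h₂ / (2 * Q * D ^ 2))) = e * (e ^ 3 * h₂) / (2 * Q * D ^ 2) := by ring
      rw [this, ← hcomb]
      field_simp
      ring
    rw [hT]
    linear_combination key - hsum

end SingleSum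

/-! ### The double sum modulo the fifth power of a cyclotomic polynomial -/

section DoubleSum

theorem sum_filter_add_le {R : Type*} [CommRing R] (f g : ℕ → R) {n : ℕ} (hn : 0 < n) :
    ∑ p ∈ Finset.range n ×ˢ Finset.range n with p.1 + p.2 ≤ n - 1, f p.1 * g p.2 =
      ∑ i ∈ Finset.range n, f i * ∑ j ∈ Finset.range (n - i), g j := by
  rw [Finset.sum_filter, Finset.sum_product]
  refine Finset.sum_congr rfl fun i hi => ?_
  rw [Finset.mul_sum, ← Finset.sum_filter]
  refine Finset.sum_congr ?_ fun _ _ => rfl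
  ext j
  simp only [Finset.mem_filter, Finset.mem_range] at *
  omega

theorem sum_range_mul_sum_range_sub_comm {R : Type*} [CommRing R] (f g : ℕ → R) (m : ℕ) :
    ∑ i ∈ Finset.range m, f i * ∑ j ∈ Finset.range (m - i), g j =
      ∑ j ∈ Finset.range m, g j * ∑ i ∈ Finset.range (m - j), f i := by
  simp only [Finset.mul_sum]
  rw [Finset.sum_comm' (t' := Finset.range m) (s' := fun j => Finset.range (m - j))]
  · exact Finset.sum_congr rfl fun _ _ => Finset.sum_congr rfl fun _ _ => mul_comm _ _
  · intro i j
    simp only [Finset.mem_range]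
    omega

/-- Two indices at most m always satisfy i + j ≤ 2m = n - 1, and at most one index can exceed m. -/
theorem sum_double_split {R : Type*} [CommRing R] (f : ℕ → R) {n m : ℕ}
    (hn : n = 2 * m + 1) :
    ∑ i ∈ Finset.range n, f i * ∑ j ∈ Finset.range (n - i), f j =
      (∑ k ∈ Finset.range (m + 1), f k) ^ 2 +
        2 * ∑ u ∈ Finset.range m, f (m + 1 + u) * ∑ k ∈ Finset.range (m - u), f k := by
  rw [hn, show 2 * m + 1 = m + 1 + m by ring, Finset.sum_range_add]
  have h1 : ∀ i ∈ Finset.range (m + 1), f i * ∑ j ∈ Finset.range (m + 1 + m - i), f j =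
      f i * (∑ k ∈ Finset.range (m + 1), f k) +
        f i * ∑ u ∈ Finset.range (m - i), f (m + 1 + u) := fun i hi => by
    have := Finset.mem_range.1 hi
    rw [show m + 1 + m - i = m + 1 + (m - i) by omega, Finset.sum_range_add, mul_add]
  have h2 : ∀ u ∈ Finset.range m, f (m + 1 + u) * ∑ j ∈ Finset.range (m + 1 + m - (m + 1 + u)), f j =
      f (m + 1 + u) * ∑ k ∈ Finset.range (m - u), f k := fun u _ => by
    rw [show m + 1 + m - (m + 1 + u) = m - u by omega]
  rw [Finset.sum_congr rfl h1, Finset.sum_congr rfl h2, Finset.sum_add_distrib, ← Finset.sum_mul,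
    Finset.sum_range_succ (fun i => f i * ∑ u ∈ Finset.range (m - i), f (m + 1 + u)),
    sum_range_mul_sum_range_sub_comm f (fun u => f (m + 1 + u))]
  simp
  ring

variable {L : Type*} [Field L] {ζ : L} {n m : ℕ}

/-- The factor with j = m has numerator 1 - q^n; the later ones are reduced at ζ by ζ^n = 1. -/
theorem exists_wpRatio_tail (hζ : IsPrimitiveRoot ζ n) (hn : n = 2 * m + 1) {u : ℕ} (hu : u < m) :
    ∃ v, HasValue ζ v (wpRatio ζ 1 m / (1 - ζ) *
        ∏ j ∈ Finset.range u, (1 - ζ ^ (2 * j + 2)) / (1 - ζ ^ (2 * j + 3))) ∧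
      wpRatio q 1 (m + 1 + u) = (1 - q ^ n) * v := by
  induction u with
  | zero =>
    have h1 : 1 - ζ ≠ 0 := by
      simpa using one_sub_pow_ne_zero_of_lt hζ (j := 1) one_pos (by omega)
    have h2 : ζ ^ (n + 1) = ζ := by rw [pow_succ, hζ.pow_eq_one, one_mul]
    refine ⟨wpRatio q 1 m / (1 - q ^ (n + 1)), ?_, ?_⟩
    · rw [Finset.prod_range_zero, mul_one]
      exact (hasValue_wpRatio_one hζ hn (by omega)).div
        ((HasValue.one_sub_pow ζ (n + 1)).congr (by rw [h2])) h1
    · rw [add_zero, wpRatio_succ, one_mul, hn]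
      ring
  | succ u ih =>
    obtain ⟨v, hv, hv'⟩ := ih (by omega)
    have h3 := one_sub_pow_ne_zero_of_lt hζ (j := 2 * u + 3) (by omega) (by omega)
    have e1 : ζ ^ (2 * (m + 1 + u) + 1) = ζ ^ (2 * u + 2) := by
      rw [show 2 * (m + 1 + u) + 1 = n + (2 * u + 2) by omega, pow_add, hζ.pow_eq_one, one_mul]
    have e2 : ζ ^ (2 * (m + 1 + u) + 2) = ζ ^ (2 * u + 3) := by
      rw [show 2 * (m + 1 + u) + 2 = n + (2 * u + 3) by omega, pow_add, hζ.pow_eq_one, one_mul]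
    refine ⟨v * ((1 - q ^ (2 * (m + 1 + u) + 1)) / (1 - q ^ (2 * (m + 1 + u) + 2))), ?_, ?_⟩
    · rw [Finset.prod_range_succ, ← mul_assoc]
      exact hv.mul (((HasValue.one_sub_pow ζ _).congr (by rw [e1])).div
        ((HasValue.one_sub_pow ζ _).congr (by rw [e2])) h3)
    · rw [← add_assoc, wpRatio_succ, hv', one_mul, mul_assoc]

theorem exists_sum_tail [CharZero L] (hζ : IsPrimitiveRoot ζ n) (hn : n = 2 * m + 1) :
    ∃ h, HasValue ζ h 0 ∧
      ∑ u ∈ Finset.range m, (1 - q ^ (4 * (m + 1 + u) + 1)) * wpRatio q 1 (m + 1 + u) ^ 4 *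
        ∑ k ∈ Finset.range (m - u), (1 - q ^ (4 * k + 1)) * wpRatio q 1 k ^ 4 =
      (1 - q ^ n) ^ 4 * h := by
  choose! v hv hv' using fun u (hu : u < m) => exists_wpRatio_tail hζ hn hu
  refine ⟨∑ u ∈ Finset.range m, (1 - q ^ (4 * (m + 1 + u) + 1)) * v u ^ 4 *
    ∑ k ∈ Finset.range (m - u), (1 - q ^ (4 * k + 1)) * wpRatio q 1 k ^ 4,
    (HasValue.sum fun u hu => ((HasValue.one_sub_pow ζ _).mul
      ((hv u (Finset.mem_range.1 hu)).pow 4)).mul (HasValue.sum fun k hk =>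
        (HasValue.one_sub_pow ζ _).mul ((hasValue_wpRatio_one hζ hn ?_).pow 4))).congr ?_, ?_⟩
  · have := Finset.mem_range.1 hk
    omega
  · rw [← mul_zero ((wpRatio ζ 1 m / (1 - ζ)) ^ 4), ← sum_tail_root hζ hn, Finset.mul_sum]
    refine Finset.sum_congr rfl fun u _ => ?_
    have e1 : ζ ^ (4 * (m + 1 + u) + 1) = ζ ^ (4 * u + 3) := by
      rw [show 4 * (m + 1 + u) + 1 = n * 2 + (4 * u + 3) by omega, pow_add, pow_mul,
        hζ.pow_eq_one, one_pow, one_mul]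
    rw [e1]
    ring
  · rw [Finset.mul_sum]
    refine Finset.sum_congr rfl fun u hu => ?_
    rw [hv' u (Finset.mem_range.1 hu)]
    ring

/-- The difference of the two sides of the congruence. -/
noncomputable def congrDiff (n : ℕ) : RatFunc ℤ :=
  ∑ p ∈ Finset.range n ×ˢ Finset.range n with p.1 + p.2 ≤ n - 1, theta p.1 * theta p.2 -
    (qInt n ^ 2 * q ^ (1 - (n : ℤ)) - 2 * qInt n ^ 4 *
      ∑ t ∈ Finset.Icc 1 ((n - 1) / 2), q ^ (2 * t + 1) / qInt (2 * t) ^ 2)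

theorem congrDiff_eq (hn : n = 2 * m + 1) :
    congrDiff n = (∑ i ∈ Finset.range n, (1 - q ^ (4 * i + 1)) * wpRatio q 1 i ^ 4 *
      ∑ j ∈ Finset.range (n - i), (1 - q ^ (4 * j + 1)) * wpRatio q 1 j ^ 4 -
      ((1 - q ^ n) ^ 2 / (q ^ m) ^ 2 - 2 * (1 - q ^ n) ^ 4 *
        ∑ j ∈ Finset.range m, q ^ (2 * j + 3) / (1 - q ^ (2 * j + 2)) ^ 2)) / (1 - q) ^ 2 := by
  have h1 := one_sub_q_ne_zero
  have hz : q ^ (1 - (n : ℤ)) = 1 / (q ^ m) ^ 2 := by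
    rw [hn, show (1 - ((2 * m + 1 : ℕ) : ℤ)) = -((m * 2 : ℕ) : ℤ) by push_cast; ring, zpow_neg,
      zpow_natCast, pow_mul, one_div]
  have ht : ∑ t ∈ Finset.Icc 1 ((n - 1) / 2), q ^ (2 * t + 1) / qInt (2 * t) ^ 2 =
      (1 - q) ^ 2 * ∑ j ∈ Finset.range m, q ^ (2 * j + 3) / (1 - q ^ (2 * j + 2)) ^ 2 := by
    rw [show (n - 1) / 2 = m by omega, Finset.mul_sum, ← Finset.Ico_succ_right_eq_Icc,
      Finset.sum_Ico_eq_sum_range]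
    refine Finset.sum_congr (by simp) fun j _ => ?_
    have h2 : 1 - q ^ (2 * j + 2) ≠ 0 := one_sub_q_pow_ne_zero (by omega)
    rw [show 2 * (1 + j) + 1 = 2 * j + 3 by ring, show 2 * (1 + j) = 2 * j + 2 by ring, qInt]
    generalize 1 - q ^ (2 * j + 2) = b at *
    generalize 1 - q = a at *
    field_simp
  rw [congrDiff, sum_filter_add_le _ _ (by omega), hz, ht, qInt]
  refine (congrArg₂ (· - ·) ?_ ?_).trans (sub_div _ _ _).symm
  · rw [Finset.sum_div]
    refine Finset.sum_congr rfl fun i _ => ?_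
    simp only [theta_eq, ← Finset.sum_div]
    rw [div_mul_div_comm, ← sq]
  · generalize ∑ j ∈ Finset.range m, q ^ (2 * j + 3) / (1 - q ^ (2 * j + 2)) ^ 2 = σ
    generalize q ^ m = T
    generalize q ^ n = E
    generalize 1 - q = a at *
    field_simp

theorem exists_congrDiff_eq [CharZero L] (hζ : IsPrimitiveRoot ζ n) (hn : n = 2 * m + 1)
    (hm : 0 < m) : ∃ h, HasValue ζ h 0 ∧ congrDiff n = (1 - q ^ n) ^ 4 * h := by
  obtain ⟨h, hh, hS⟩ := exists_sum_theta hζ hn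
  obtain ⟨g, hg, hT⟩ := exists_sum_tail hζ hn
  have hζ0 : ζ ≠ 0 := hζ.ne_zero (by omega)
  have he := HasValue.one_sub_q_pow_order hζ
  have hq := HasValue.indeterminate ζ
  have hσ : HasValue ζ (∑ j ∈ Finset.range m, q ^ (2 * j + 2) / (1 - q ^ (2 * j + 2)) ^ 2)
      (∑ j ∈ Finset.range m, ζ ^ (2 * j + 2) / (1 - ζ ^ (2 * j + 2)) ^ 2) :=
    HasValue.sum fun j hj => (hq.pow _).div ((HasValue.one_sub_pow ζ _).pow 2)
      (pow_ne_zero _ (one_sub_pow_ne_zero_of_lt hζ (by omega)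
        (by have := Finset.mem_range.1 hj; omega)))
  have hσ' : ∑ j ∈ Finset.range m, q ^ (2 * j + 3) / (1 - q ^ (2 * j + 2)) ^ 2 =
      q * ∑ j ∈ Finset.range m, q ^ (2 * j + 2) / (1 - q ^ (2 * j + 2)) ^ 2 := by
    rw [Finset.mul_sum]; exact Finset.sum_congr rfl fun j _ => by ring
  have h1ζ : 1 - ζ ≠ 0 := by
    simpa using one_sub_pow_ne_zero_of_lt hζ (j := 1) one_pos (by omega)
  rw [congrDiff_eq hn, sum_double_split _ hn, hT, hS, hσ']
  generalize ∑ j ∈ Finset.range m, q ^ (2 * j + 2) / (1 - q ^ (2 * j + 2)) ^ 2 = σ at *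
  generalize ∑ j ∈ Finset.range m, ζ ^ (2 * j + 2) / (1 - ζ ^ (2 * j + 2)) ^ 2 = s at *
  have hqm := (hq.pow m)
  have hζm : ζ ^ m ≠ 0 := pow_ne_zero _ hζ0
  have hqm0 : q ^ m ≠ 0 := pow_ne_zero _ q_ne_zero
  have hpow : ζ * (ζ ^ m) ^ 2 = 1 := by rw [← hζ.pow_eq_one, hn]; ring
  generalize hQ : 1 - q ^ n = e at *
  -- The coefficient of e^4 after squaring the head. Each group vanishes at ζ: the first because
  -- ζ^{-2m} = ζ, the others through e, h and g.
  refine ⟨(2 * σ * (q - 1 / (q ^ m) ^ 2) + e ^ 2 * (σ ^ 2 / (q ^ m) ^ 2 + h ^ 2) +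
    2 * h * (1 - e ^ 2 * σ) / q ^ m + 2 * g) / (1 - q) ^ 2,
    ((((((HasValue.two ζ).mul hσ).mul (hq.sub ((HasValue.one ζ).div (hqm.pow 2)
      (pow_ne_zero _ hζm)))).add ((he.pow 2).mul (((hσ.pow 2).div (hqm.pow 2)
      (pow_ne_zero _ hζm)).add (hh.pow 2)))).add ((((HasValue.two ζ).mul hh).mul
      ((HasValue.one ζ).sub ((he.pow 2).mul hσ))).div hqm hζm)).add
      ((HasValue.two ζ).mul hg)).div (((HasValue.one ζ).sub hq).pow 2)
      (pow_ne_zero _ h1ζ) |>.congr ?_, ?_⟩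
  · have : 1 / (ζ ^ m) ^ 2 = ζ := by rw [div_eq_iff (pow_ne_zero _ hζm), hpow]
    rw [this]
    simp
  · rw [mul_div_assoc']
    congr 1
    generalize q ^ m = T at *
    field_simp
    ring

theorem cyclotomic_pow_five_dvd_num [CharZero L] (hζ : IsPrimitiveRoot ζ n) (hn : n = 2 * m + 1)
    (hm : 0 < m) : cyclotomic n ℤ ^ 5 ∣ IsFractionRing.num ℤ[X] (congrDiff n) := by
  have hn0 : 0 < n := by omega
  obtain ⟨h, hh, hd⟩ := exists_congrDiff_eq hζ hn hm
  obtain ⟨a, ha, ha'⟩ := hh.exists_eq_cyclotomic_mul hn0 hζ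
  obtain ⟨b, hb, hb'⟩ := (HasValue.one_sub_q_pow_order hζ).exists_eq_cyclotomic_mul hn0 hζ
  refine cyclotomic_pow_dvd_num hn0 hζ (mul_mem (pow_mem hb 4) ha) ?_
  rw [hd, ha', hb']
  ring

end DoubleSum

/-! ### The double sum modulo the other cyclotomic polynomials -/

section Divisors

variable {L : Type*} [Field L] {ζ : L} {d μ : ℕ}

theorem wpRatio_add {K : Type*} [Field K] (q y : K) (a b : ℕ) :
    wpRatio q y (a + b) = wpRatio q y a *
      ∏ j ∈ Finset.range b, (y - q ^ (2 * (a + j) + 1)) / (1 - y * q ^ (2 * (a + j) + 2)) :=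
  Finset.prod_range_add _ _ _

theorem coprime_two_of_eq (hd : d = 2 * μ + 1) : d.Coprime 2 := by rw [hd]; simp

theorem one_sub_pow_even_ne_zero (hζ : IsPrimitiveRoot ζ d) (hd : d = 2 * μ + 1) (l : ℕ) {j : ℕ}
    (hj : j + 1 < d) : 1 - ζ ^ (2 * (d * l + j) + 2) ≠ 0 := by
  refine one_sub_pow_ne_zero hζ fun h => ?_
  rw [show 2 * (d * l + j) + 2 = d * (2 * l) + 2 * (j + 1) by ring,
    Nat.dvd_add_right (dvd_mul_right d _)] at h
  have := Nat.le_of_dvd (by omega) ((coprime_two_of_eq hd).dvd_of_dvd_mul_left h)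
  omega

theorem one_sub_q_pow_mem (k : ℕ) : 1 - q ^ k ∈ regularRing ζ := (HasValue.one_sub_pow ζ k).mem

theorem one_sub_q_pow_div_mem [CharZero L] (hζ : IsPrimitiveRoot ζ d) (hd : 0 < d) {a b : ℕ}
    (ha : d ∣ a) (hb : 0 < b) : (1 - q ^ a) / (1 - q ^ b) ∈ regularRing ζ := by
  by_cases hdb : d ∣ b
  · obtain ⟨a, rfl⟩ := ha
    obtain ⟨b, rfl⟩ := hdb
    have h0 : 1 - q ^ d ≠ 0 := one_sub_q_pow_ne_zero hd
    have hg : ∀ k, HasValue ζ (∑ i ∈ Finset.range k, (q ^ d) ^ i) (k : L) := fun k =>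
      (HasValue.sum fun i _ => ((HasValue.indeterminate ζ).pow d).pow i).congr (by
        simp [hζ.pow_eq_one])
    have hb0 : (b : L) ≠ 0 := Nat.cast_ne_zero.2 (Nat.pos_of_mul_pos_left hb).ne'
    rw [pow_mul, pow_mul, ← geom_sum_mul_neg (q ^ d) a, ← geom_sum_mul_neg (q ^ d) b,
      mul_div_mul_right _ _ h0]
    exact ((hg a).div (hg b) hb0).mem
  · exact ((HasValue.one_sub_pow ζ a).div (HasValue.one_sub_pow ζ b)
      (one_sub_pow_ne_zero hζ hdb)).mem

theorem wpRatio_mul_mem [CharZero L] (hζ : IsPrimitiveRoot ζ d) (hd : d = 2 * μ + 1) (l : ℕ) :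
    wpRatio q 1 (d * l) ∈ regularRing ζ := by
  induction l with
  | zero => rw [mul_zero, wpRatio_zero]; exact one_mem _
  | succ l ih =>
    rw [mul_add, mul_one, wpRatio_add]
    refine mul_mem ih ?_
    simp only [one_mul]
    -- In a block of d factors the numerator vanishes at ζ for j = μ, with exponent d(2l+1), and the
    -- denominator only for j = 2μ. The quotient of these two is regular.
    rw [Finset.prod_div_distrib, ← Finset.mul_prod_erase _ _ (Finset.mem_range.2
      (show μ < d by omega))]
    have hden : ∏ j ∈ Finset.range d, (1 - q ^ (2 * (d * l + j) + 2)) =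
        ∏ j ∈ Finset.range (2 * μ + 1), (1 - q ^ (2 * (d * l + j) + 2)) := by rw [← hd]
    rw [hden, Finset.prod_range_succ, mul_comm (∏ x ∈ Finset.range (2 * μ), _), mul_div_mul_comm]
    refine mul_mem (one_sub_q_pow_div_mem hζ (by omega) ⟨2 * l + 1, ?_⟩ (by omega)) ?_
    · rw [hd]; ring
    · rw [div_eq_mul_inv, ← Finset.prod_inv_distrib]
      refine mul_mem (prod_mem fun j _ => one_sub_q_pow_mem _) (prod_mem fun j hj => ?_)
      exact ((HasValue.one_sub_pow ζ _).inv (one_sub_pow_even_ne_zero hζ hd l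
        (by have := Finset.mem_range.1 hj; omega))).mem

/-- A Lucas-type property: beyond a multiple of d, the factors at ζ depend only on the residue of
the index. -/
theorem exists_hasValue_wpRatio [CharZero L] (hζ : IsPrimitiveRoot ζ d) (hd : d = 2 * μ + 1) :
    ∃ c : ℕ → L, ∀ l k, k < d → HasValue ζ (wpRatio q 1 (d * l + k)) (c l * wpRatio ζ 1 k) := by
  choose c hc using fun l => mem_regularRing.1 (wpRatio_mul_mem hζ hd l)
  refine ⟨c, fun l k hk => ?_⟩
  rw [wpRatio_add]
  refine (hc l).mul (HasValue.prod fun j hj => ?_)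
  have hj := Finset.mem_range.1 hj
  have h1 : ∀ i, ζ ^ (2 * (d * l + j) + i) = ζ ^ (2 * j + i) := fun i => by
    rw [show 2 * (d * l + j) + i = d * (2 * l) + (2 * j + i) by ring, pow_add, pow_mul,
      hζ.pow_eq_one, one_pow, one_mul]
  have h2 := one_sub_pow_even_ne_zero hζ hd l (j := j) (by omega)
  simp only [one_mul]
  rw [h1] at h2
  exact ((HasValue.one_sub_pow ζ _).congr (by rw [h1])).div
    ((HasValue.one_sub_pow ζ _).congr (by rw [h1])) h2

theorem sum_block_eq_zero {c t : ℕ → L} {μ d : ℕ} (hd : d = 2 * μ + 1)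
    (ht : ∀ k, μ < k → k < d → t k = 0) (hs : ∑ k ∈ Finset.range (μ + 1), t k = 0) (a : ℕ) {b : ℕ}
    (hb : μ < b) (hbd : b ≤ d) :
    ∑ j ∈ Finset.range (d * a + b), c (j / d) * t (j % d) = 0 := by
  have hblock : ∀ a b, μ < b → b ≤ d →
      ∑ j ∈ Finset.range b, c ((d * a + j) / d) * t ((d * a + j) % d) = 0 := fun a b hb hbd => by
    have h1 : ∑ j ∈ Finset.range b, c ((d * a + j) / d) * t ((d * a + j) % d) =
        ∑ j ∈ Finset.range b, c a * t j := Finset.sum_congr rfl fun j hj => by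
      have hj : j < d := (Finset.mem_range.1 hj).trans_le hbd
      rw [Nat.mul_add_mod, Nat.mod_eq_of_lt hj, Nat.mul_add_div (by omega), Nat.div_eq_of_lt hj,
        add_zero]
    rw [h1, ← Finset.mul_sum, ← Finset.sum_subset (Finset.range_mono (show μ + 1 ≤ b from hb))
      fun k hk hk' => ht k (by rw [Finset.mem_range] at hk'; omega)
        ((Finset.mem_range.1 hk).trans_le hbd), hs, mul_zero]
  induction a generalizing b with
  | zero => simpa using hblock 0 b hb hbd
  | succ a ih =>
    rw [Finset.sum_range_add, hblock (a + 1) b hb hbd, mul_add, mul_one,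
      ih (show μ < d by omega) le_rfl, add_zero]

theorem hasValue_congrDiff [CharZero L] (hζ : IsPrimitiveRoot ζ d) (hd : d = 2 * μ + 1) {n m : ℕ}
    (hn : n = 2 * m + 1) (hdn : d ∣ n) (hd1 : 1 < d) : HasValue ζ (congrDiff n) 0 := by
  obtain ⟨c, hc⟩ := exists_hasValue_wpRatio hζ hd
  have hd0 : 0 < d := by omega
  have he : HasValue ζ (1 - q ^ n) 0 := (HasValue.one_sub_pow ζ n).congr (by
    rw [(hζ.pow_eq_one_iff_dvd n).2 hdn, sub_self])
  have h1ζ : 1 - ζ ≠ 0 := by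
    simpa using one_sub_pow_ne_zero_of_lt hζ (j := 1) one_pos (by omega)
  have hθ : ∀ i, HasValue ζ ((1 - q ^ (4 * i + 1)) * wpRatio q 1 i ^ 4)
      (c (i / d) ^ 4 * ((1 - ζ ^ (4 * (i % d) + 1)) * wpRatio ζ 1 (i % d) ^ 4)) := fun i => by
    have h1 := hc (i / d) (i % d) (Nat.mod_lt _ hd0)
    rw [Nat.div_add_mod] at h1
    refine ((HasValue.one_sub_pow ζ _).mul (h1.pow 4)).congr ?_
    have h2 : ζ ^ (4 * i + 1) = ζ ^ (4 * (i % d) + 1) := by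
      conv_lhs => rw [← Nat.div_add_mod i d]
      rw [show 4 * (d * (i / d) + i % d) + 1 = d * (4 * (i / d)) + (4 * (i % d) + 1) by ring,
        pow_add, pow_mul, hζ.pow_eq_one, one_pow, one_mul]
    rw [h2]
    ring
  set t : ℕ → L := fun k => (1 - ζ ^ (4 * k + 1)) * wpRatio ζ 1 k ^ 4 with ht
  have ht0 : ∀ k, μ < k → k < d → t k = 0 := fun k hk _ => by
    have := wpRatio_eq_zero ζ hk
    rw [← hd, hζ.pow_eq_one] at this
    simp [ht, this]
  have hsum : ∑ i ∈ Finset.range n, c (i / d) ^ 4 * t (i % d) *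
      ∑ j ∈ Finset.range (n - i), c (j / d) ^ 4 * t (j % d) = 0 :=
    Finset.sum_eq_zero fun i hi => by
      have hi := Finset.mem_range.1 hi
      have hmod := Nat.mod_lt i hd0
      by_cases hk : μ < i % d
      · rw [ht0 _ hk hmod, mul_zero, zero_mul]
      · obtain ⟨N, rfl⟩ := hdn
        have hl : i / d < N := Nat.div_lt_of_lt_mul hi
        -- The last block of the inner range has length d - i % d, which is at least μ + 1 because i
        -- % d ≤ μ; hence it contains all nonzero terms of a block.
        have hni : d * N - i = d * (N - (i / d + 1)) + (d - i % d) := by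
          obtain ⟨r, hr⟩ := Nat.exists_eq_add_of_lt hl
          have h1 := Nat.div_add_mod i d
          have h2 : d * N = d * (i / d) + d * r + d := by
            conv_lhs => rw [hr]
            ring
          rw [show N - (i / d + 1) = r by omega]
          omega
        rw [hni, sum_block_eq_zero (c := fun l => c l ^ 4) hd ht0 (sum_theta_root hζ hd) _
          (by omega) (by omega), mul_zero]
  have hlhs : HasValue ζ (∑ i ∈ Finset.range n, (1 - q ^ (4 * i + 1)) * wpRatio q 1 i ^ 4 *
      ∑ j ∈ Finset.range (n - i), (1 - q ^ (4 * j + 1)) * wpRatio q 1 j ^ 4) 0 :=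
    (HasValue.sum fun i _ => (hθ i).mul (HasValue.sum fun j _ => hθ j)).congr hsum
  have hq := HasValue.indeterminate ζ
  have hσ : (1 - q ^ n) ^ 2 * ∑ j ∈ Finset.range m, q ^ (2 * j + 3) / (1 - q ^ (2 * j + 2)) ^ 2 ∈
      regularRing ζ := by
    rw [Finset.mul_sum]
    refine sum_mem fun j _ => ?_
    rw [show (1 - q ^ n) ^ 2 * (q ^ (2 * j + 3) / (1 - q ^ (2 * j + 2)) ^ 2) =
      q ^ (2 * j + 3) * ((1 - q ^ n) / (1 - q ^ (2 * j + 2))) ^ 2 by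
        rw [div_pow, mul_div_left_comm]]
    exact mul_mem (hq.pow _).mem (pow_mem (one_sub_q_pow_div_mem hζ hd0 hdn (by omega)) 2)
  obtain ⟨s, hs⟩ := hσ
  have hrhs : HasValue ζ ((1 - q ^ n) ^ 2 / (q ^ m) ^ 2 - 2 * (1 - q ^ n) ^ 4 *
      ∑ j ∈ Finset.range m, q ^ (2 * j + 3) / (1 - q ^ (2 * j + 2)) ^ 2) 0 := by
    have h := ((he.pow 2).div ((hq.pow m).pow 2)
      (pow_ne_zero _ (pow_ne_zero _ (hζ.ne_zero (by omega))))).sub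
      (((HasValue.two ζ).mul (he.pow 2)).mul hs)
    rw [show 2 * (1 - q ^ n) ^ 2 * ((1 - q ^ n) ^ 2 *
      ∑ j ∈ Finset.range m, q ^ (2 * j + 3) / (1 - q ^ (2 * j + 2)) ^ 2) = 2 * (1 - q ^ n) ^ 4 *
      ∑ j ∈ Finset.range m, q ^ (2 * j + 3) / (1 - q ^ (2 * j + 2)) ^ 2 by ring] at h
    exact h.congr (by simp)
  rw [congrDiff_eq hn]
  exact ((hlhs.sub hrhs).div (((HasValue.one ζ).sub hq).pow 2) (pow_ne_zero _ h1ζ)).congr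
    (by simp)

theorem cyclotomic_dvd_num [CharZero L] (hζ : IsPrimitiveRoot ζ d) (hd : d = 2 * μ + 1) {n m : ℕ}
    (hn : n = 2 * m + 1) (hdn : d ∣ n) (hd1 : 1 < d) :
    cyclotomic d ℤ ∣ IsFractionRing.num ℤ[X] (congrDiff n) := by
  obtain ⟨g, hg, h⟩ := (hasValue_congrDiff hζ hd hn hdn hd1).exists_eq_cyclotomic_mul (by omega) hζ
  simpa using cyclotomic_pow_dvd_num (by omega) hζ (k := 1) hg (by rw [pow_one, h])

end Divisors

/-! ### Assembly over the divisors of n -/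

theorem isRelPrime_cyclotomic {a b : ℕ} (ha : 0 < a) (hb : 0 < b) (hab : a ≠ b) :
    IsRelPrime (cyclotomic a ℤ) (cyclotomic b ℤ) := by
  rw [(cyclotomic.irreducible ha).isRelPrime_iff_not_dvd]
  intro h
  have h1 := (cyclotomic.irreducible ha).associated_of_dvd (cyclotomic.irreducible hb) h
  exact hab (cyclotomic_injective
    (eq_of_monic_of_associated (cyclotomic.monic a ℤ) (cyclotomic.monic b ℤ) h1))

end QCong

theorem mainTheorem3 (n : ℕ) (hn : Odd n) :
    QCong.RatCongr (QCong.qIntPoly n * Polynomial.cyclotomic n ℤ ^ 4)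
      (∑ p ∈ Finset.range n ×ˢ Finset.range n with p.1 + p.2 ≤ n - 1,
        QCong.theta p.1 * QCong.theta p.2)
      (QCong.qInt n ^ 2 * QCong.q ^ (1 - (n : ℤ))
        - 2 * QCong.qInt n ^ 4 *
          ∑ t ∈ Finset.Icc 1 ((n - 1) / 2),
            QCong.q ^ (2 * t + 1) / QCong.qInt (2 * t) ^ 2) := by
  change _ ∣ IsFractionRing.num ℤ[X] (QCong.congrDiff n)
  obtain ⟨m, hm⟩ := hn
  rcases Nat.eq_zero_or_pos m with rfl | hm0
  · have h0 : QCong.congrDiff n = 0 := by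
      rw [QCong.congrDiff_eq hm, hm]
      simp [QCong.wpRatio_zero, ← sq]
    rw [h0, IsFractionRing.num_zero]
    exact dvd_zero _
  · have hn0 : 0 < n := by omega
    have hmem : n ∈ n.divisors.erase 1 := by simp; omega
    -- The factor Φ_n of [n] joins Φ_n^4, which is why a fifth power is needed at d = n and a first
    -- power elsewhere.
    have hP : QCong.qIntPoly n * cyclotomic n ℤ ^ 4 =
        ∏ d ∈ n.divisors.erase 1, cyclotomic d ℤ ^ (if d = n then 5 else 1) := by
      rw [QCong.qIntPoly, ← prod_cyclotomic_eq_geom_sum hn0, ← Finset.mul_prod_erase _ _ hmem,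
        ← Finset.mul_prod_erase _ (fun d => cyclotomic d ℤ ^ _) hmem, if_pos rfl,
        Finset.prod_congr rfl fun d hd => show cyclotomic d ℤ ^ (if d = n then 5 else 1) =
          cyclotomic d ℤ by rw [if_neg (Finset.ne_of_mem_erase hd), pow_one]]
      ring
    rw [hP]
    refine Finset.prod_dvd_of_isRelPrime (fun a ha b hb hab => ?_) fun d hd => ?_
    · have ha' := Nat.pos_of_mem_divisors (Finset.mem_of_mem_erase ha)
      have hb' := Nat.pos_of_mem_divisors (Finset.mem_of_mem_erase hb)
      exact (QCong.isRelPrime_cyclotomic ha' hb' hab).pow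
    · have hd0 := Nat.pos_of_mem_divisors (Finset.mem_of_mem_erase hd)
      have hd1 := Finset.ne_of_mem_erase hd
      have hdn := Nat.dvd_of_mem_divisors (Finset.mem_of_mem_erase hd)
      have hζ := Complex.isPrimitiveRoot_exp d hd0.ne'
      split_ifs with h
      · subst h
        exact QCong.cyclotomic_pow_five_dvd_num hζ hm hm0
      · obtain ⟨μ, hμ⟩ := Odd.of_dvd_nat ⟨m, hm⟩ hdn
        rw [pow_one]
        exact QCong.cyclotomic_dvd_num hζ hμ hm hdn (by omega)
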